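/- Theorem. Let $M=(S,S_\Box,S_\bigcirc,\to,P)$ be a Markov decision process (MDP) with a countable state space $S=S_\Box\uplus S_\bigcirc$ of controlled and random states, in which every state has at least one, and possibly infinitely many, successors under $\to$, and $P$ assigns to every random state a probability distribution over its successors. Strategies $\sigma$ may be history dependent and randomized: they map every partial run that ends in a controlled state $s$ to a distribution over the successors of $s$. Let $\mathbb P_{M,s,\sigma}$ be the induced probability measure on infinite sequences of states starting in $s$. An MD strategy is a memoryless deterministic one, i.e. a function that maps every controlled state to one of its successors. The value of $s$ for an objective (a measurable set of infinite sequences of states) $\varphi$ is $\mathrm{val}_M(s)=\sup_\sigma\mathbb P_{M,s,\sigma}(\varphi)$; the strategy $\sigma$ is $\varepsilon$-optimal from $s$ if $\mathbb P_{M,s,\sigma}(\varphi)\ge \mathrm{val}_M(s)-\varepsilon$, optimal from $s$ if this holds with $\varepsilon=0$, and uniformly $\varepsilon$-optimal if it is $\varepsilon$-optimal from every state. Let $\mathit{Col}:S\to\{0,1,2\}$ be a coloring and let $\varphi$ be the parity objective, the set of runs in which the largest color that occurs infinitely often is even. Let $\mathrm{val}_M$ be the value for $\varphi$, let $S_{\mathrm{opt}}$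 be the set of states that have an optimal strategy for $\varphi$ in $M$, and let $M_*$ be the conditioned MDP of $M$ with respect to $\varphi$: its state space is $S_*=\{s\in S_{\mathrm{opt}} : \mathrm{val}_M(s)>0\}$, split into controlled and random states as in $M$; there is a transition $s\to_* t$ if and only if $s,t\in S_*$, $s\to t$ and, in case $s$ is controlled, $\mathrm{val}_M(s)=\mathrm{val}_M(t)$; and $P_*(s)(t)=P(s)(t)\cdot\mathrm{val}_M(t)/\mathrm{val}_M(s)$ for random $s\in S_*$ and $t\in S_*$ with $s\to_* t$. (This is a well-defined MDP.) Suppose that for every $T\subseteq S_*$ and every $\varepsilon>0$ there is an MD strategy in $M_*$ that is uniformly $\varepsilon$-optimal for the safety objective "never visit $T$". Then there is a single MD strategy in $M$ that is optimal for $\varphi$ from every state in $S_{\mathrm{opt}}$. -/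

import Mathlib

open MeasureTheory ProbabilityTheory Filter
open scoped ENNReal

set_option linter.unusedSectionVars false

/-- A Markov decision process with state space `S` (taken countable below). The random states are
those outside `controlled`. Every state has a successor, and `prob` assigns to every random state
a probability distribution over its successors. Branching may be infinite. -/
structure MDP (S : Type*) where
  controlled : Set S
  trans : S → S → Prop
  exists_succ : ∀ s, ∃ t, trans s t
  prob : {s : S // s ∉ controlled} → PMF S
  trans_of_prob : ∀ s t, prob s t ≠ 0 → trans s t

namespace MDP

/-- A (history dependent, randomized) strategy: `act w s` is the distribution chosen after the
partial run `w s` that ends in the controlled state `s`, a distribution over the successors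
of `s`. -/
structure Strategy {S : Type*} (M : MDP S) where
  act : List S → {s : S // s ∈ M.controlled} → PMF S
  trans_of_act : ∀ w s t, act w s t ≠ 0 → M.trans s t

/-- An MD (memoryless deterministic) strategy: it maps every controlled state to one of its
successors. -/
structure MDStrategy {S : Type*} (M : MDP S) where
  next : {s : S // s ∈ M.controlled} → S
  trans_next : ∀ s : {s : S // s ∈ M.controlled}, M.trans s (next s)

/-- An MD strategy, seen as a strategy. -/
noncomputable def MDStrategy.toStrategy {S : Type*} {M : MDP S} (σ : M.MDStrategy) :
    M.Strategy where
  act := fun _ s => PMF.pure (σ.next s)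
  trans_of_act := fun w s t h => by
    have : t = σ.next s := by
      by_contra hne
      exact h (by simp [PMF.pure_apply, hne])
    rw [this]
    exact σ.trans_next s

open Classical in
/-- The distribution of the next state after the partial run `w s`: given by the strategy if `s` is
controlled, and by the probability function of the MDP if `s` is random. -/
noncomputable def Strategy.step {S : Type*} {M : MDP S} (σ : M.Strategy) (w : List S) (s : S) :
    PMF S :=
  if h : s ∈ M.controlled then σ.act w ⟨s, h⟩ else M.prob ⟨s, h⟩

section RunMeasure

variable {S : Type*} [Countable S] [MeasurableSpace S] [MeasurableSingletonClass S] {M : MDP S}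

/-- The transition kernel of the `n`-th step: from `s₀ s₁ ⋯ sₙ` to the next state. -/
noncomputable def Strategy.kernel (σ : M.Strategy) (n : ℕ) :
    Kernel ((i : Finset.Iic n) → (fun _ : ℕ => S) i) S :=
  Kernel.ofFunOfCountable fun x =>
    (σ.step (List.ofFn fun i : Fin n => x ⟨i, Finset.mem_Iic.2 i.isLt.le⟩)
      (x ⟨n, Finset.mem_Iic.2 le_rfl⟩)).toMeasure

instance (σ : M.Strategy) (n : ℕ) : IsMarkovKernel (σ.kernel n) :=
  ⟨fun _ => by
    change IsProbabilityMeasure (PMF.toMeasure _)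
    infer_instance⟩

/-- The probability measure on infinite sequences of states that is induced by the initial state
`s` and the strategy `σ`; see `runMeasure_cylinder` for its values on cylinders. -/
noncomputable def Strategy.runMeasure (σ : M.Strategy) (s : S) : Measure (ℕ → S) :=
  Kernel.traj (X := fun _ => S) σ.kernel 0 fun _ => s

instance (σ : M.Strategy) (s : S) : IsProbabilityMeasure (σ.runMeasure s) := by
  unfold Strategy.runMeasure
  infer_instance

open Classical in
theorem Strategy.runMeasure_map (σ : M.Strategy) (s : S) (n : ℕ) (ω : ℕ → S) :
    ((σ.runMeasure s).map (Preorder.frestrictLe n)) {Preorder.frestrictLe n ω} =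
      (if ω 0 = s then 1 else 0) *
        ∏ i ∈ Finset.range n, σ.step (List.ofFn fun j : Fin i => ω j) (ω i) (ω (i + 1)) := by
  rw [Strategy.runMeasure, Kernel.traj_map_frestrictLe_apply]
  induction n with
  | zero =>
    rw [Kernel.partialTraj_self, Kernel.id_apply,
      Measure.dirac_apply' _ (measurableSet_singleton _)]
    simp only [Set.indicator, Set.mem_singleton_iff, Finset.range_zero, Finset.prod_empty, mul_one,
      Pi.one_apply]
    refine if_congr ?_ rfl rfl
    constructor
    · intro h
      exact (congrFun h ⟨0, by simp⟩).symm
    · intro h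
      funext i
      have : (i : ℕ) = 0 := Nat.le_zero.1 (Finset.mem_Iic.1 i.2)
      simp [Preorder.frestrictLe_apply, this, h]
  | succ n ih =>
    have hmeas : MeasurableSet (IicProdIoc (X := fun _ : ℕ => S) n (n + 1) ⁻¹'
        {Preorder.frestrictLe (n + 1) ω}) :=
      measurable_IicProdIoc (X := fun _ : ℕ => S) (measurableSet_singleton _)
    rw [Kernel.partialTraj_succ_of_le (Nat.zero_le n), Kernel.map_apply' _ (by fun_prop) _
      (measurableSet_singleton _), Kernel.comp_apply' _ _ _ hmeas]
    have hpre : IicProdIoc (X := fun _ : ℕ => S) n (n + 1) ⁻¹' {Preorder.frestrictLe (n + 1) ω} =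
        {Preorder.frestrictLe n ω} ×ˢ ((MeasurableEquiv.piSingleton (X := fun _ : ℕ => S) n) ''
          {ω (n + 1)}) := by
      ext p
      simp only [Set.mem_preimage, Set.mem_singleton_iff, Set.mem_prod, Set.image_singleton]
      constructor
      · intro h
        constructor
        · funext i
          have hi : (i : ℕ) ≤ n := Finset.mem_Iic.1 i.2
          have := congrFun h ⟨i, Finset.mem_Iic.2 (by omega)⟩
          simpa [IicProdIoc, hi, Preorder.frestrictLe_apply] using this
        · funext i
          have hi : n < (i : ℕ) ∧ (i : ℕ) ≤ n + 1 := Finset.mem_Ioc.1 i.2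
          have hi' : (i : ℕ) = n + 1 := by omega
          have := congrFun h ⟨i, Finset.mem_Iic.2 hi.2⟩
          have hn : ¬ (i : ℕ) ≤ n := by omega
          simp only [IicProdIoc, hn, dif_neg, not_false_eq_true,
            Preorder.frestrictLe_apply] at this
          rw [this]
          simp [MeasurableEquiv.piSingleton, hi']
      · rintro ⟨h1, h2⟩
        funext i
        have hi' : (i : ℕ) ≤ n + 1 := Finset.mem_Iic.1 i.2
        by_cases hi : (i : ℕ) ≤ n
        · simp [IicProdIoc, hi, h1, Preorder.frestrictLe_apply]
        · have hi2 : (i : ℕ) = n + 1 := by omega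
          simp [IicProdIoc, h2, Preorder.frestrictLe_apply, MeasurableEquiv.piSingleton, hi2]
    have hint : ∀ y : (i : Finset.Iic n) → S,
        ((Kernel.id ×ₖ (σ.kernel n).map (MeasurableEquiv.piSingleton (X := fun _ : ℕ => S) n)) y)
          (IicProdIoc (X := fun _ : ℕ => S) n (n + 1) ⁻¹' {Preorder.frestrictLe (n + 1) ω}) =
        Set.indicator {Preorder.frestrictLe n ω} (fun _ =>
          (σ.step (List.ofFn fun j : Fin n => ω j) (ω n) (ω (n + 1)) : ℝ≥0∞)) y := by
      intro y
      rw [hpre, Kernel.prod_apply, Measure.prod_prod, Kernel.id_apply,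
        Measure.dirac_apply' _ (measurableSet_singleton _), Kernel.map_apply' _
        (MeasurableEquiv.measurable _) _ ((MeasurableEquiv.measurableSet_image _).2
          (measurableSet_singleton _)), Set.preimage_image_eq _ (MeasurableEquiv.injective _)]
      by_cases hy : y = Preorder.frestrictLe n ω
      · subst hy
        simp only [Set.mem_singleton_iff, Set.indicator_of_mem, Pi.one_apply, one_mul]
        exact PMF.toMeasure_apply_singleton _ _ (measurableSet_singleton _)
      · simp [hy]
    simp_rw [hint]
    rw [lintegral_indicator (measurableSet_singleton _), setLIntegral_const, ih,
      Finset.prod_range_succ]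
    ring


open Classical in
/-- The probability of the cylinder of all sequences with prefix `ω 0, …, ω n`. -/
theorem Strategy.runMeasure_cylinder (σ : M.Strategy) (s : S) (n : ℕ) (ω : ℕ → S) :
    σ.runMeasure s {ρ | ∀ i ≤ n, ρ i = ω i} =
      (if ω 0 = s then 1 else 0) *
        ∏ i ∈ Finset.range n, σ.step (List.ofFn fun j : Fin i => ω j) (ω i) (ω (i + 1)) := by
  rw [← σ.runMeasure_map s n ω, Measure.map_apply (by fun_prop) (measurableSet_singleton _)]
  congr 1
  ext ρ
  simp [funext_iff, Preorder.frestrictLe_apply]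

theorem measurableSet_cylinder (n : ℕ) (ω : ℕ → S) :
    MeasurableSet {ρ : ℕ → S | ∀ i ≤ n, ρ i = ω i} := by
  measurability

theorem ext_of_cylinder [Nonempty S] {μ ν : Measure (ℕ → S)} [IsFiniteMeasure μ] [IsFiniteMeasure ν]
    (h : ∀ n (ω : ℕ → S), μ {ρ | ∀ i ≤ n, ρ i = ω i} = ν {ρ | ∀ i ≤ n, ρ i = ω i}) : μ = ν := by
  let P : (I : Finset ℕ) → Measure ((i : I) → S) := fun I => μ.map I.restrict
  have hP : IsProjectiveMeasureFamily (α := fun _ : ℕ => S) P := by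
    intro I J hJI
    simp only [P]
    rw [Measure.map_map (by fun_prop) (by fun_prop)]
    rfl
  have : ∀ I, IsFiniteMeasure (P I) := fun I => by
    simp only [P]
    infer_instance
  refine IsProjectiveLimit.unique (P := P) (fun I => rfl) ?_
  rw [isProjectiveLimit_nat_iff hP]
  intro n
  refine Measure.ext_of_singleton fun y => ?_
  obtain ⟨ω, rfl⟩ : ∃ ω : ℕ → S, Preorder.frestrictLe n ω = y :=
    ⟨fun i => if hi : i ≤ n then y ⟨i, Finset.mem_Iic.2 hi⟩ else Classical.arbitrary S, by
      funext i
      have hi : (i : ℕ) ≤ n := Finset.mem_Iic.1 i.2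
      simp [Preorder.frestrictLe_apply, hi]⟩
  have hset : Preorder.frestrictLe (π := fun _ : ℕ => S) n ⁻¹' {Preorder.frestrictLe n ω} =
      {ρ | ∀ i ≤ n, ρ i = ω i} := by
    ext ρ
    simp [funext_iff, Preorder.frestrictLe_apply]
  have e1 := h n ω
  rw [← hset] at e1
  rw [Measure.map_apply (by fun_prop) (measurableSet_singleton _), ← e1]
  exact (Measure.map_apply (by fun_prop) (measurableSet_singleton _)).symm

/-- The infinite sequence `s ρ`. -/
def seqCons (s : S) (ρ : ℕ → S) : ℕ → S
  | 0 => s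
  | n + 1 => ρ n

theorem measurable_seqCons (s : S) : Measurable (seqCons s) := by
  refine measurable_pi_lambda _ fun n => ?_
  cases n with
  | zero => exact measurable_const
  | succ n => exact measurable_pi_apply n

/-- The strategy that plays like `σ` does after a first visit to `s`. -/
def Strategy.shift (σ : M.Strategy) (s : S) : M.Strategy where
  act := fun w u => σ.act (s :: w) u
  trans_of_act := fun w u t h => σ.trans_of_act (s :: w) u t h

theorem Strategy.shift_step (σ : M.Strategy) (s : S) (w : List S) (u : S) :
    (σ.shift s).step w u = σ.step (s :: w) u := rfl

/-- The strategy that makes the first move like `σ`, and then switches to `τ t` if the second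
state is `t`. -/
def Strategy.glue (σ : M.Strategy) (τ : S → M.Strategy) : M.Strategy where
  act := fun w u => match w with
    | [] => σ.act [] u
    | _ :: w => (τ (w.headD u)).act w u
  trans_of_act := fun w u t h => by
    cases w with
    | nil => exact σ.trans_of_act _ _ _ h
    | cons a w => exact (τ _).trans_of_act _ _ _ h

theorem Strategy.runMeasure_congr [Nonempty S] (σ τ : M.Strategy) (s : S)
    (h0 : σ.step [] s = τ.step [] s)
    (h1 : ∀ w u, σ.step (s :: w) u = τ.step (s :: w) u) : σ.runMeasure s = τ.runMeasure s := by
  classical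
  refine ext_of_cylinder fun n ω => ?_
  rw [σ.runMeasure_cylinder, τ.runMeasure_cylinder]
  by_cases hs : ω 0 = s
  · congr 1
    refine Finset.prod_congr rfl fun i _ => ?_
    cases i with
    | zero => simp [hs, h0]
    | succ i =>
      rw [List.ofFn_succ]
      simp only [Fin.val_zero, hs, h1]
  · simp [hs]

theorem Strategy.runMeasure_step [Nonempty S] (σ : M.Strategy) (s : S) {A : Set (ℕ → S)}
    (hA : MeasurableSet A) : σ.runMeasure s A =
      ∑' t, σ.step [] s t * (σ.shift s).runMeasure t (seqCons s ⁻¹' A) := by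
  classical
  let ν : Measure (ℕ → S) := Measure.sum fun t =>
    σ.step [] s t • ((σ.shift s).runMeasure t).map (seqCons s)
  have hν : ∀ {B : Set (ℕ → S)}, MeasurableSet B → ν B =
      ∑' t, σ.step [] s t * (σ.shift s).runMeasure t (seqCons s ⁻¹' B) := by
    intro B hB
    simp only [ν]
    rw [Measure.sum_apply _ hB]
    refine tsum_congr fun t => ?_
    rw [Measure.smul_apply, Measure.map_apply (measurable_seqCons s) hB, smul_eq_mul]
  have hfin : IsFiniteMeasure ν := ⟨by
    rw [hν MeasurableSet.univ]
    simp [PMF.tsum_coe]⟩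
  rw [← hν hA]
  congr 1
  refine ext_of_cylinder fun n ω => ?_
  rw [hν (measurableSet_cylinder n ω), σ.runMeasure_cylinder]
  by_cases hs : ω 0 = s
  · cases n with
    | zero =>
      have : seqCons s ⁻¹' {ρ | ∀ i ≤ 0, ρ i = ω i} = Set.univ := by
        ext ρ
        simp [seqCons, hs]
      rw [this]
      simp [PMF.tsum_coe, hs]
    | succ n =>
      have : seqCons s ⁻¹' {ρ | ∀ i ≤ n + 1, ρ i = ω i} =
          {ρ | ∀ i ≤ n, ρ i = (fun k => ω (k + 1)) i} := by
        ext ρ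
        constructor
        · intro h i hi
          exact h (i + 1) (by omega)
        · intro h i hi
          cases i with
          | zero => exact hs.symm
          | succ i => exact h i (by omega)
      rw [this]
      simp_rw [Strategy.runMeasure_cylinder]
      rw [tsum_eq_single (ω 1) (fun t ht => by simp [Ne.symm ht])]
      rw [Finset.prod_range_succ']
      simp only [hs, if_true, one_mul, zero_add, List.ofFn_zero, Strategy.shift_step,
        List.ofFn_succ, Fin.val_zero, Fin.val_succ]
      rw [mul_comm]
  · have : seqCons s ⁻¹' {ρ | ∀ i ≤ n, ρ i = ω i} = ∅ := by
      ext ρ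
      simp only [Set.mem_preimage, Set.mem_ofPred_eq, Set.mem_empty_iff_false, iff_false]
      intro h
      exact hs (h 0 (Nat.zero_le n)).symm
    simp [this, hs]

/-- A tail objective: adding or removing a finite prefix does not matter. -/
def IsTail {S : Type*} (φ : Set (ℕ → S)) : Prop :=
  ∀ (ρ : ℕ → S) (n : ℕ), (fun k => ρ (n + k)) ∈ φ ↔ ρ ∈ φ

/-- The value of the state `s` (the supremum over all strategies) for the objective `φ`. -/
noncomputable def value (M : MDP S) (φ : Set (ℕ → S)) (s : S) : ℝ≥0∞ :=
  ⨆ σ : M.Strategy, σ.runMeasure s φ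

/-- The strategy `σ` is `ε`-optimal from `s`. -/
def Strategy.IsEpsOptimalFrom (σ : M.Strategy) (φ : Set (ℕ → S)) (ε : ℝ) (s : S) : Prop :=
  M.value φ s - ENNReal.ofReal ε ≤ σ.runMeasure s φ

/-- The strategy `σ` is optimal from `s`: it attains the value. -/
def Strategy.IsOptimalFrom (σ : M.Strategy) (φ : Set (ℕ → S)) (s : S) : Prop :=
  σ.runMeasure s φ = M.value φ s

/-- The states that have an optimal strategy. -/
def optStates (M : MDP S) (φ : Set (ℕ → S)) : Set S :=
  {s | ∃ σ : M.Strategy, σ.IsOptimalFrom φ s}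

/-- The states of positive value that have an optimal strategy. -/
def condStates (M : MDP S) (φ : Set (ℕ → S)) : Set S :=
  {s | s ∈ M.optStates φ ∧ 0 < M.value φ s}

theorem value_le_one (M : MDP S) (φ : Set (ℕ → S)) (s : S) : M.value φ s ≤ 1 :=
  iSup_le fun _ => prob_le_one

theorem value_ne_top (M : MDP S) (φ : Set (ℕ → S)) (s : S) : M.value φ s ≠ ∞ :=
  ne_top_of_le_ne_top ENNReal.one_ne_top (M.value_le_one φ s)

theorem Strategy.runMeasure_tail (σ : M.Strategy) (s : S) {φ : Set (ℕ → S)}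
    (hm : MeasurableSet φ) (ht : IsTail φ) :
    σ.runMeasure s φ = ∑' t, σ.step [] s t * (σ.shift s).runMeasure t φ := by
  have : Nonempty S := ⟨s⟩
  rw [σ.runMeasure_step s hm]
  have hpre : seqCons s ⁻¹' φ = φ := by
    ext ρ
    rw [Set.mem_preimage, ← ht (seqCons s ρ) 1]
    have : (fun k => seqCons s ρ (1 + k)) = ρ := by
      funext k
      rw [add_comm]
      rfl
    rw [this]
  rw [hpre]

theorem Strategy.tsum_value_le (σ : M.Strategy) (s : S) {φ : Set (ℕ → S)}
    (hm : MeasurableSet φ) (ht : IsTail φ) :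
    ∑' t, σ.step [] s t * M.value φ t ≤ M.value φ s := by
  have : Nonempty S := ⟨s⟩
  refine ENNReal.le_of_forall_pos_le_add fun ε hε _ => ?_
  have hex : ∀ t, ∃ τ : M.Strategy, M.value φ t ≤ τ.runMeasure t φ + ε := by
    intro t
    by_contra! hcon
    have h1 : M.value φ t ≤ M.value φ t - ε :=
      iSup_le fun τ => ENNReal.le_sub_of_add_le_right ENNReal.coe_ne_top (hcon τ).le
    have h2 : M.value φ t ≠ 0 := fun h0 => by simpa [h0] using hcon σ
    exact absurd h1 (not_le.2 (ENNReal.sub_lt_self (M.value_ne_top φ t) h2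
      (by exact_mod_cast hε.ne')))
  choose τ hτ using hex
  have hglue : ∀ t, ((σ.glue τ).shift s).runMeasure t = (τ t).runMeasure t := fun t =>
    Strategy.runMeasure_congr _ _ t rfl fun _ _ => rfl
  calc ∑' t, σ.step [] s t * M.value φ t
      ≤ ∑' t, (σ.step [] s t * (τ t).runMeasure t φ + σ.step [] s t * ε) := by
        refine ENNReal.tsum_le_tsum fun t => ?_
        rw [← mul_add]
        gcongr
        exact hτ t
    _ = (∑' t, σ.step [] s t * (τ t).runMeasure t φ) + ε := by
        rw [ENNReal.tsum_add, ENNReal.tsum_mul_right, PMF.tsum_coe, one_mul]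
    _ = (σ.glue τ).runMeasure s φ + ε := by
        rw [(σ.glue τ).runMeasure_tail s hm ht]
        simp_rw [hglue]
        rfl
    _ ≤ M.value φ s + ε := by
        gcongr
        exact le_iSup (fun τ : M.Strategy => τ.runMeasure s φ) _

theorem Strategy.IsOptimalFrom.tsum_value {σ : M.Strategy} {s : S} {φ : Set (ℕ → S)}
    (hσ : σ.IsOptimalFrom φ s) (hm : MeasurableSet φ) (ht : IsTail φ) :
    ∑' t, σ.step [] s t * M.value φ t = M.value φ s := by
  refine le_antisymm (σ.tsum_value_le s hm ht) ?_
  rw [← hσ, σ.runMeasure_tail s hm ht]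
  refine ENNReal.tsum_le_tsum fun t => ?_
  gcongr
  exact le_iSup (fun τ : M.Strategy => τ.runMeasure t φ) _

theorem Strategy.IsOptimalFrom.mem_optStates {σ : M.Strategy} {s t : S} {φ : Set (ℕ → S)}
    (hσ : σ.IsOptimalFrom φ s) (hm : MeasurableSet φ) (ht : IsTail φ) (hst : σ.step [] s t ≠ 0) :
    t ∈ M.optStates φ := by
  refine ⟨σ.shift s, ?_⟩
  have hle : ∀ u, (σ.shift s).runMeasure u φ ≤ M.value φ u := fun u =>
    le_iSup (fun τ : M.Strategy => τ.runMeasure u φ) _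
  refine le_antisymm (hle t) ?_
  by_contra! hlt
  have hfin : ∑' u, σ.step [] s u * (σ.shift s).runMeasure u φ ≠ ∞ := by
    rw [← σ.runMeasure_tail s hm ht]
    exact measure_ne_top _ _
  have := ENNReal.tsum_lt_tsum hfin (g := fun u => σ.step [] s u * M.value φ u)
    (fun u => by gcongr; exact hle u)
    (i := t) (ENNReal.mul_lt_mul_right hst (PMF.apply_ne_top _ _) hlt)
  rw [← σ.runMeasure_tail s hm ht, hσ.tsum_value hm ht, hσ] at this
  exact lt_irrefl _ this

open Classical in
theorem value_le_of_trans {s t : S} {φ : Set (ℕ → S)} (hm : MeasurableSet φ) (ht : IsTail φ)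
    (hs : s ∈ M.controlled) (hst : M.trans s t) : M.value φ t ≤ M.value φ s := by
  let σ : M.MDStrategy :=
    { next := fun u => if u.1 = s then t else (M.exists_succ u).choose
      trans_next := fun u => by
        split_ifs with h
        · rw [h]
          exact hst
        · exact (M.exists_succ u).choose_spec }
  have hstep : σ.toStrategy.step [] s = PMF.pure t := by
    simp [Strategy.step, hs, MDStrategy.toStrategy, σ]
  have := σ.toStrategy.tsum_value_le s hm ht
  rw [hstep, tsum_eq_single t (fun u hu => by simp [PMF.pure_apply, hu])] at this
  simpa using this

theorem Strategy.trans_of_step (σ : M.Strategy) (w : List S) (s t : S) (h : σ.step w s t ≠ 0) :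
    M.trans s t := by
  unfold Strategy.step at h
  split_ifs at h with hs
  · exact σ.trans_of_act _ _ _ h
  · exact M.trans_of_prob _ _ h

theorem tsum_prob_mul_value {φ : Set (ℕ → S)} (hm : MeasurableSet φ) (ht : IsTail φ) (s : S)
    (hs : s ∉ M.controlled) (hc : s ∈ M.condStates φ) :
    ∑' t : M.condStates φ, M.prob ⟨s, hs⟩ t * M.value φ t = M.value φ s := by
  obtain ⟨⟨σ, hσ⟩, -⟩ := hc
  have hstep : σ.step [] s = M.prob ⟨s, hs⟩ := by simp [Strategy.step, hs]
  rw [← hσ.tsum_value hm ht, hstep]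
  refine tsum_subtype_eq_of_support_subset (f := fun t => M.prob ⟨s, hs⟩ t * M.value φ t) ?_
  intro t h
  have h' : M.prob ⟨s, hs⟩ t ≠ 0 ∧ M.value φ t ≠ 0 := by simpa using h
  exact ⟨hσ.mem_optStates hm ht (by rw [hstep]; exact h'.1), pos_iff_ne_zero.2 h'.2⟩

theorem exists_cond_succ {φ : Set (ℕ → S)} (hm : MeasurableSet φ) (ht : IsTail φ)
    (s : M.condStates φ) : ∃ t : M.condStates φ, M.trans s t ∧
      ((s : S) ∈ M.controlled → M.value φ s = M.value φ t) := by
  obtain ⟨s, hs⟩ := s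
  by_cases hc : s ∈ M.controlled
  · obtain ⟨⟨σ, hσ⟩, hpos⟩ := hs
    obtain ⟨t, hstep⟩ := (σ.step [] s).support_nonempty
    rw [PMF.mem_support_iff] at hstep
    have hval : M.value φ s = M.value φ t := by
      refine le_antisymm ?_ (value_le_of_trans hm ht hc (σ.trans_of_step _ _ _ hstep))
      by_contra! hlt
      have hle : ∀ u, σ.step [] s u * M.value φ u ≤ σ.step [] s u * M.value φ s := by
        intro u
        by_cases hu : σ.step [] s u = 0
        · simp [hu]
        · gcongr
          exact value_le_of_trans hm ht hc (σ.trans_of_step _ _ _ hu)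
      have hfin : ∑' u, σ.step [] s u * M.value φ u ≠ ∞ := by
        rw [hσ.tsum_value hm ht]
        exact M.value_ne_top φ s
      have := ENNReal.tsum_lt_tsum hfin hle
        (i := t) (ENNReal.mul_lt_mul_right hstep (PMF.apply_ne_top _ _) hlt)
      rw [hσ.tsum_value hm ht, ENNReal.tsum_mul_right, PMF.tsum_coe, one_mul] at this
      exact lt_irrefl _ this
    exact ⟨⟨t, hσ.mem_optStates hm ht hstep, hval ▸ hpos⟩, σ.trans_of_step _ _ _ hstep,
      fun _ => hval⟩
  · have hsum := tsum_prob_mul_value hm ht s hc hs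
    have hne : ∑' t : M.condStates φ, M.prob ⟨s, hc⟩ t * M.value φ t ≠ 0 := by
      rw [hsum]
      exact hs.2.ne'
    obtain ⟨t, hmul⟩ : ∃ t : M.condStates φ, M.prob ⟨s, hc⟩ t * M.value φ t ≠ 0 := by
      by_contra! hcon
      exact hne (by simp [hcon])
    exact ⟨t, M.trans_of_prob ⟨s, hc⟩ t (left_ne_zero_of_mul hmul), fun h => absurd h hc⟩

/-- The conditioned version of `M` with respect to a (measurable) tail objective `φ`. Its states are
the states of `M` with positive value that have an optimal strategy; controlled states keep only the
transitions that preserve the value, and `P s t` becomes `P s t * value t / value s`. The fields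
that are propositions contain the proof that this is an MDP. -/
noncomputable def conditioned (M : MDP S) (φ : Set (ℕ → S)) (hm : MeasurableSet φ)
    (ht : IsTail φ) : MDP (M.condStates φ) where
  controlled := {s | (s : S) ∈ M.controlled}
  trans := fun s t => M.trans s t ∧ ((s : S) ∈ M.controlled → M.value φ s = M.value φ t)
  exists_succ := exists_cond_succ hm ht
  prob := fun s => ⟨fun t => M.prob ⟨s.1, s.2⟩ t * (M.value φ t / M.value φ s.1), by
    have hpos : 0 < M.value φ s.1 := s.1.2.2
    have h := tsum_prob_mul_value hm ht s.1 s.2 s.1.2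
    have : ∑' t : M.condStates φ, M.prob ⟨s.1, s.2⟩ t * (M.value φ t / M.value φ s.1) = 1 := by
      simp_rw [← mul_div_assoc, div_eq_mul_inv]
      rw [ENNReal.tsum_mul_right, h]
      exact ENNReal.mul_inv_cancel hpos.ne' (M.value_ne_top φ s.1)
    exact (Summable.hasSum_iff ENNReal.summable).2 this⟩
  trans_of_prob := fun s t h =>
    ⟨M.trans_of_prob ⟨s.1, s.2⟩ t (left_ne_zero_of_mul h), fun hc => absurd hc s.2⟩

/-- The parity objective of the coloring `col`: some even color is seen infinitely often and is the
largest color that is seen infinitely often. -/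
def parity {S : Type*} (col : S → ℕ) : Set (ℕ → S) :=
  {ρ | ∃ c, Even c ∧ (∃ᶠ n in atTop, col (ρ n) = c) ∧ ∀ᶠ n in atTop, col (ρ n) ≤ c}

/-- The safety objective: never visit `T`. -/
def safety {S : Type*} (T : Set S) : Set (ℕ → S) :=
  {ρ | ∀ n, ρ n ∉ T}

theorem isTail_parity {S : Type*} (col : S → ℕ) : IsTail (parity col) := by
  intro ρ n
  have key : ∀ p : ℕ → Prop, (∀ᶠ k in atTop, p (n + k)) ↔ ∀ᶠ k in atTop, p k := by
    intro p
    have h : map (fun k => k + n) atTop = atTop := map_add_atTop_eq_nat n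
    conv_rhs => rw [← h, eventually_map]
    simp_rw [add_comm]
  unfold parity
  simp only [Set.mem_ofPred_eq, Filter.Frequently]
  refine exists_congr fun c => and_congr_right fun _ => and_congr ?_ ?_
  · exact not_congr (key fun k => ¬ col (ρ k) = c)
  · exact key fun k => col (ρ k) ≤ c

theorem measurableSet_parity (col : S → ℕ) : MeasurableSet (parity col) := by
  have hcol : Measurable col := measurable_of_countable col
  have h : ∀ (n : ℕ) (D : Set ℕ), MeasurableSet {ρ : ℕ → S | col (ρ n) ∈ D} := fun n D =>
    (hcol.comp (measurable_pi_apply n)) (MeasurableSet.of_discrete (s := D))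
  have heq : parity col = ⋃ c ∈ {c : ℕ | Even c},
      ((⋂ a : ℕ, ⋃ b ∈ {b : ℕ | a ≤ b}, {ρ : ℕ → S | col (ρ b) ∈ ({c} : Set ℕ)}) ∩
        ⋃ a : ℕ, ⋂ b ∈ {b : ℕ | a ≤ b}, {ρ : ℕ → S | col (ρ b) ∈ Set.Iic c}) := by
    ext ρ
    simp [parity, frequently_atTop, eventually_atTop, and_left_comm]
  rw [heq]
  refine MeasurableSet.biUnion (Set.to_countable _) fun c _ => MeasurableSet.inter ?_ ?_
  · exact MeasurableSet.iInter fun a => MeasurableSet.biUnion (Set.to_countable _) fun b _ => h b _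
  · exact MeasurableSet.iUnion fun a => MeasurableSet.biInter (Set.to_countable _) fun b _ => h b _

/-- The MD strategy `σ` is uniformly `ε`-optimal: it is `ε`-optimal from every state. -/
def MDStrategy.IsUniformlyEpsOptimal (σ : M.MDStrategy) (φ : Set (ℕ → S)) (ε : ℝ) : Prop :=
  ∀ s, σ.toStrategy.IsEpsOptimalFrom φ ε s

end RunMeasure

end MDP

/-! The theorem reduces to almost sure winning in the conditioned MDP. An optimal strategy of `M`,
transferred to `M_*`, satisfies val(s) · P_*(C) = P(φ ∩ C) for cylinders C, hence wins almost surely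
there (`Strategy.IsOptimalFrom.runMeasure_conditioned`). Conversely, for equal memoryless choices
val(s) · P_* ≤ P, so an MD strategy that wins almost surely in `M_*` is optimal in `M`
(`MDStrategy.isOptimalFrom_of_conditioned`). States of value 0 need nothing.

So let every state be able to win almost surely. Let σ be the safety strategy for T, the states of
color 1, with ε = 1/3, and let u(s) be its safety probability from s. Put R = {u ≥ 1/3} and G =
{color 2} ∪ {u ≥ 2/3}. Outside R every strategy is safe with probability below 2/3, so avoiding T ∪
R ∪ G forever has probability 0 by the zero law below. A winning run without color 2 eventually
avoids color 1, so R ∪ G is reachable almost surely. By the same law safe runs of σ almost surely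
reach G, so σ reaches G from R with probability at least 1/3. Hence G remains almost surely
reachable once the choices in R are fixed to those of σ, and a single MD strategy σ' that copies σ
on R reaches G almost surely from everywhere. From u ≥ 2/3, σ' stays in R with probability at least
1/3 and then never sees color 1. So the event "never color 2, infinitely often color 1" has
probability at most 2/3 from G, hence from everywhere, hence 0. Every losing run has a suffix in it.

Zero law (`Strategy.runMeasure_eq_zero_of_le`): an event that survives deletion of the first state,
and whose probability is at most c < 1 from every state and for every strategy of a class closed
under shifts, is null.

Memoryless reachability (`IsReaching.exists_graph`): the states are treated one by one. A memoryless
strategy that reaches G from s with probability above 2/3 is frozen where it succeeds with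
probability at least 1/3; later changes cost at most 1/3 from s. The limit strategy succeeds with
probability at least 1/3 from everywhere, hence with probability 1. -/

namespace MDP

/-! ### Domination of measures on cylinders, and the zero law -/

section Cylinders

variable {S : Type*} [Countable S] [MeasurableSpace S] [MeasurableSingletonClass S] {M : MDP S}

/-- There are only countably many prefixes of a given length, so the comparison can be summed over
them. -/
theorem measure_preimage_frestrictLe_le {μ ν : Measure (ℕ → S)}
    (h : ∀ n (ω : ℕ → S), ν {ρ | ∀ i ≤ n, ρ i = ω i} ≤ μ {ρ | ∀ i ≤ n, ρ i = ω i}) (n : ℕ)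
    (V : Set ((i : Finset.Iic n) → S)) :
    ν (Preorder.frestrictLe (π := fun _ : ℕ => S) n ⁻¹' V) ≤
      μ (Preorder.frestrictLe (π := fun _ : ℕ => S) n ⁻¹' V) := by
  have hV : MeasurableSet V := V.to_countable.measurableSet
  rw [← Measure.map_apply (by fun_prop) hV, ← Measure.map_apply (by fun_prop) hV,
    ← Measure.tsum_indicator_apply_singleton _ _ hV,
    ← Measure.tsum_indicator_apply_singleton _ _ hV]
  refine ENNReal.tsum_le_tsum fun y => Set.indicator_le_indicator ?_
  rw [Measure.map_apply (by fun_prop) (measurableSet_singleton _),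
    Measure.map_apply (by fun_prop) (measurableSet_singleton _)]
  by_cases hS : Nonempty S
  · obtain ⟨ω, rfl⟩ : ∃ ω : ℕ → S, Preorder.frestrictLe n ω = y :=
      ⟨fun i => if hi : i ≤ n then y ⟨i, Finset.mem_Iic.2 hi⟩ else Classical.arbitrary S, by
        funext i
        have hi : (i : ℕ) ≤ n := Finset.mem_Iic.1 i.2
        simp [Preorder.frestrictLe_apply, hi]⟩
    have hset : Preorder.frestrictLe (π := fun _ : ℕ => S) n ⁻¹' {Preorder.frestrictLe n ω} =
        {ρ | ∀ i ≤ n, ρ i = ω i} := by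
      ext ρ
      simp [funext_iff, Preorder.frestrictLe_apply]
    rw [hset]
    exact h n ω
  · exact absurd ⟨y ⟨0, by simp⟩⟩ hS

/-- A measure on infinite sequences that is dominated by another one on cylinders is dominated by
it. -/
theorem measure_le_of_cylinder {μ ν : Measure (ℕ → S)} [IsFiniteMeasure μ]
    (h : ∀ n (ω : ℕ → S), ν {ρ | ∀ i ≤ n, ρ i = ω i} ≤ μ {ρ | ∀ i ≤ n, ρ i = ω i}) : ν ≤ μ := by
  -- With the discrete topology, open sets are increasing unions of sets determined by a prefix, and
  -- outer regularity of `μ` carries the bound from open sets to all measurable sets.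
  let _ : TopologicalSpace S := ⊥
  have _ : DiscreteTopology S := ⟨rfl⟩
  have hopen : ∀ U : Set (ℕ → S), IsOpen U → ν U ≤ μ U := by
    intro U hU
    let V : (n : ℕ) → Set ((i : Finset.Iic n) → S) := fun n =>
      {y | ∀ ρ : ℕ → S, Preorder.frestrictLe n ρ = y → ρ ∈ U}
    have hmono : Monotone fun n => Preorder.frestrictLe (π := fun _ : ℕ => S) n ⁻¹' V n := by
      intro m n hmn ρ hρ ρ' hρ'
      refine hρ ρ' ?_
      funext i
      have hi : (i : ℕ) ≤ m := Finset.mem_Iic.1 i.2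
      exact congrFun hρ' ⟨i, Finset.mem_Iic.2 (hi.trans hmn)⟩
    have hUV : U = ⋃ n, Preorder.frestrictLe (π := fun _ : ℕ => S) n ⁻¹' V n := by
      ext ρ
      simp only [Set.mem_iUnion]
      refine ⟨fun hρ => ?_, fun ⟨n, hn⟩ => hn ρ rfl⟩
      obtain ⟨_, ⟨x, n, rfl⟩, hx, hsub⟩ :=
        (PiNat.isTopologicalBasis_cylinders fun _ : ℕ => S).exists_subset_of_mem_open hρ hU
      refine ⟨n, fun ρ' hρ' => hsub fun i hi => ?_⟩
      have := congrFun hρ' ⟨i, Finset.mem_Iic.2 hi.le⟩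
      exact this.trans (hx i hi)
    rw [hUV, hmono.measure_iUnion, hmono.measure_iUnion]
    exact iSup_mono fun n => measure_preimage_frestrictLe_le h n _
  refine Measure.le_iff.2 fun A _ => ENNReal.le_of_forall_pos_le_add fun ε hε _ => ?_
  obtain ⟨U, hAU, hU, hle⟩ := A.exists_isOpen_le_add μ (ENNReal.coe_ne_zero.2 hε.ne')
  exact (measure_mono hAU).trans ((hopen U hU).trans hle)

theorem preimage_seqCons_cylinder (n : ℕ) (ω : ℕ → S) :
    seqCons (ω 0) ⁻¹' {ρ | ∀ i ≤ n + 1, ρ i = ω i} = {ρ | ∀ i ≤ n, ρ i = ω (i + 1)} := by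
  ext ρ
  constructor
  · intro h i hi
    exact h (i + 1) (by omega)
  · intro h i hi
    cases i with
    | zero => rfl
    | succ i => exact h i (by omega)

namespace Strategy

theorem runMeasure_eq_zero (σ : M.Strategy) (s : S) {A : Set (ℕ → S)} (hA : MeasurableSet A)
    (h : ∀ ρ ∈ A, ρ 0 ≠ s) : σ.runMeasure s A = 0 := by
  have : Nonempty S := ⟨s⟩
  have hpre : seqCons s ⁻¹' A = ∅ := by
    ext ρ
    simp only [Set.mem_preimage, Set.mem_empty_iff_false, iff_false]
    exact fun hρ => h _ hρ rfl
  rw [σ.runMeasure_step s hA]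
  simp [hpre]

theorem runMeasure_eq_one (σ : M.Strategy) (s : S) {A : Set (ℕ → S)} (hA : MeasurableSet A)
    (h : ∀ ρ, ρ 0 = s → ρ ∈ A) : σ.runMeasure s A = 1 := by
  rw [← prob_compl_eq_zero_iff hA]
  exact σ.runMeasure_eq_zero s hA.compl fun ρ hρ h0 => hρ (h ρ h0)

/-- If all strategies of a class that is closed under shifts give a set at most the probability
`c < 1`, then they give it the probability zero. -/
theorem runMeasure_eq_zero_of_le {Γ : Set M.Strategy} (hΓ : ∀ σ ∈ Γ, ∀ s, σ.shift s ∈ Γ)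
    {Z : Set (ℕ → S)} (hm : MeasurableSet Z) (hZ : ∀ s ρ, seqCons s ρ ∈ Z → ρ ∈ Z) {c : ℝ≥0∞}
    (hc : c < 1) (hle : ∀ σ ∈ Γ, ∀ s, σ.runMeasure s Z ≤ c) :
    ∀ σ ∈ Γ, ∀ s, σ.runMeasure s Z = 0 := by
  -- After any prefix the rest of the run still lies in `Z` and the strategy still lies in `Γ`, so
  -- the conditional probability of `Z` is at most `c`.
  have hcyl : ∀ n (ω : ℕ → S), ∀ σ ∈ Γ, ∀ s, σ.runMeasure s ({ρ | ∀ i ≤ n, ρ i = ω i} ∩ Z) ≤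
      c * σ.runMeasure s {ρ | ∀ i ≤ n, ρ i = ω i} := by
    intro n
    induction n with
    | zero =>
      intro ω σ hσ s
      by_cases h0 : ω 0 = s
      · rw [σ.runMeasure_eq_one s (measurableSet_cylinder 0 ω) (by simp [h0]), mul_one]
        exact (measure_mono Set.inter_subset_right).trans (hle σ hσ s)
      · rw [σ.runMeasure_eq_zero s ((measurableSet_cylinder 0 ω).inter hm)
          (fun ρ hρ h => h0 (by rw [← h]; exact (hρ.1 0 le_rfl).symm))]
        exact zero_le
    | succ n ih =>
      intro ω σ hσ s
      have : Nonempty S := ⟨s⟩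
      by_cases h0 : ω 0 = s
      · subst h0
        rw [σ.runMeasure_step _ ((measurableSet_cylinder _ ω).inter hm),
          σ.runMeasure_step _ (measurableSet_cylinder _ ω), ← ENNReal.tsum_mul_left]
        refine ENNReal.tsum_le_tsum fun t => ?_
        rw [mul_left_comm]
        gcongr
        rw [Set.preimage_inter, preimage_seqCons_cylinder]
        refine le_trans (measure_mono ?_) (ih _ _ (hΓ σ hσ _) t)
        exact Set.inter_subset_inter_right _ fun ρ hρ => hZ _ ρ hρ
      · rw [σ.runMeasure_eq_zero s ((measurableSet_cylinder _ ω).inter hm)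
          (fun ρ hρ h => h0 (by rw [← h]; exact (hρ.1 0 (Nat.zero_le _)).symm))]
        exact zero_le
  intro σ hσ s
  have hdom : (σ.runMeasure s).restrict Z ≤ c • σ.runMeasure s := by
    have hcf : IsFiniteMeasure (c • σ.runMeasure s) :=
      Measure.smul_finite _ (hc.trans ENNReal.one_lt_top).ne
    refine measure_le_of_cylinder fun n ω => ?_
    rw [Measure.restrict_apply (measurableSet_cylinder n ω), Measure.smul_apply, smul_eq_mul]
    exact hcyl n ω σ hσ s
  -- Domination on cylinders extends to `Z` itself and gives μ(Z) ≤ c · μ(Z).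
  have hself := hdom Z
  rw [Measure.restrict_apply hm, Set.inter_self, Measure.smul_apply, smul_eq_mul] at hself
  by_contra hne
  have hlt := ENNReal.mul_lt_mul_left hne (measure_ne_top (σ.runMeasure s) Z) hc
  rw [one_mul] at hlt
  exact absurd hself (not_le.2 hlt)

theorem measurable_seqShift (n : ℕ) : Measurable fun (ρ : ℕ → S) k => ρ (n + k) :=
  measurable_pi_lambda _ fun _ => measurable_pi_apply _

theorem runMeasure_iUnion_shift_eq_zero {Γ : Set M.Strategy} (hΓ : ∀ σ ∈ Γ, ∀ s, σ.shift s ∈ Γ)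
    {Z : Set (ℕ → S)} (hm : MeasurableSet Z) (hZ : ∀ σ ∈ Γ, ∀ s, σ.runMeasure s Z = 0) :
    ∀ σ ∈ Γ, ∀ s, σ.runMeasure s (⋃ n, {ρ | (fun k => ρ (n + k)) ∈ Z}) = 0 := by
  intro σ hσ s
  refine measure_iUnion_null fun n => ?_
  induction n generalizing σ s with
  | zero =>
    simp only [zero_add]
    exact hZ σ hσ s
  | succ n ih =>
    have : Nonempty S := ⟨s⟩
    have hmn : MeasurableSet {ρ : ℕ → S | (fun k => ρ (n + 1 + k)) ∈ Z} :=
      measurable_seqShift (n + 1) hm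
    rw [σ.runMeasure_step s hmn, ENNReal.tsum_eq_zero]
    intro t
    have hpre : seqCons s ⁻¹' {ρ | (fun k => ρ (n + 1 + k)) ∈ Z} =
        {ρ | (fun k => ρ (n + k)) ∈ Z} := by
      ext ρ
      have : (fun k => seqCons s ρ (n + 1 + k)) = fun k => ρ (n + k) := by
        funext k
        rw [add_right_comm]
        rfl
      simp [this]
    rw [hpre, ih _ (hΓ σ hσ s), mul_zero]

end Strategy

theorem measurableSet_safety (T : Set S) : MeasurableSet (safety T) := by
  have : safety T = ⋂ n, (fun ρ : ℕ → S => ρ n) ⁻¹' Tᶜ := by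
    ext ρ
    simp [safety]
  rw [this]
  exact MeasurableSet.iInter fun n => measurable_pi_apply n (MeasurableSet.of_discrete)

theorem mem_safety_of_seqCons {T : Set S} {s : S} {ρ : ℕ → S} (h : seqCons s ρ ∈ safety T) :
    ρ ∈ safety T := fun n => h (n + 1)

end Cylinders

/-! ### The one-step operator and reachability values -/

section Bellman

theorem inv_three_add_inv_three_lt_one : (3 : ℝ≥0∞)⁻¹ + 3⁻¹ < 1 := by
  conv_rhs => rw [← ENNReal.inv_three_add_inv_three]
  exact ENNReal.lt_add_right (by simp) (by simp)

theorem tsum_mul_iSup_of_monotone {S : Type*} (p : S → ℝ≥0∞) {f : ℕ → S → ℝ≥0∞}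
    (hf : Monotone f) : ∑' t, p t * ⨆ n, f n t = ⨆ n, ∑' t, p t * f n t := by
  let _ : MeasurableSpace S := ⊤
  simp_rw [ENNReal.mul_iSup, ← lintegral_count]
  exact lintegral_iSup (fun n => measurable_from_top)
    fun m n hmn t => mul_le_mul_right (hf hmn t) (p t)

variable {S : Type*} (M : MDP S)

open Classical in
/-- The one-step operator of the MDP in which a controlled state `s` may choose the successors `t`
with `A s t`. -/
noncomputable def bellman (A : S → S → Prop) (f : S → ℝ≥0∞) (s : S) : ℝ≥0∞ :=
  if h : s ∈ M.controlled then ⨆ t : {t // A s t}, f t else ∑' t, M.prob ⟨s, h⟩ t * f t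

/-- The relation that allows only the successor chosen by `g`. -/
def graph (g : S → S) : S → S → Prop := fun s t => t = g s

open Classical in
/-- The largest probability of reaching `G` within `n` steps, under the restriction `A` on the
choices. -/
noncomputable def reachWithin (A : S → S → Prop) (G : Set S) : ℕ → S → ℝ≥0∞
  | 0 => fun s => if s ∈ G then 1 else 0
  | n + 1 => fun s => if s ∈ G then 1 else M.bellman A (reachWithin A G n) s

/-- The value of reaching `G` under the restriction `A` on the choices. -/
noncomputable def reachSup (A : S → S → Prop) (G : Set S) (s : S) : ℝ≥0∞ :=
  ⨆ n, M.reachWithin A G n s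

variable {M} {A B : S → S → Prop} {G H R : Set S} {f f' : S → ℝ≥0∞} {g : S → S} {s : S}

theorem bellman_mono (h : ∀ t, f t ≤ f' t) : M.bellman A f s ≤ M.bellman A f' s := by
  unfold bellman
  split_ifs
  · exact iSup_mono fun t => h t
  · exact ENNReal.tsum_le_tsum fun t => mul_le_mul_right (h t) _

theorem bellman_mono_rel (h : s ∈ M.controlled → ∀ t, A s t → B s t) :
    M.bellman A f s ≤ M.bellman B f s := by
  unfold bellman
  split_ifs with hs
  · exact iSup_le fun t => le_iSup (fun t : {t // B s t} => f t) ⟨t, h hs t t.2⟩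
  · exact le_rfl

theorem bellman_graph_of_controlled (hs : s ∈ M.controlled) :
    M.bellman (graph g) f s = f (g s) := by
  rw [bellman, dif_pos hs]
  refine le_antisymm (iSup_le fun ⟨t, ht⟩ => ?_)
    (le_iSup (fun t : {t // graph g s t} => f t) ⟨g s, rfl⟩)
  cases ht
  exact le_rfl

theorem bellman_graph_congr {g' : S → S} (h : s ∈ M.controlled → g s = g' s) :
    M.bellman (graph g) f s = M.bellman (graph g') f s := by
  by_cases hs : s ∈ M.controlled
  · rw [bellman_graph_of_controlled hs, bellman_graph_of_controlled hs, h hs]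
  · simp [bellman, hs]

/-- Suprema commute at controlled states, and monotone convergence applies at random ones. Infinite
branching therefore does no harm to the fixed point equation of `reachSup`. -/
theorem bellman_iSup {F : ℕ → S → ℝ≥0∞} (hF : Monotone F) :
    M.bellman A (fun t => ⨆ n, F n t) s = ⨆ n, M.bellman A (F n) s := by
  unfold bellman
  split_ifs
  · exact iSup_comm
  · exact tsum_mul_iSup_of_monotone _ hF

theorem bellman_const_mul (c : ℝ≥0∞) :
    M.bellman A (fun t => c * f t) s = c * M.bellman A f s := by
  unfold bellman
  split_ifs
  · rw [ENNReal.mul_iSup]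
  · simp_rw [mul_left_comm _ c]
    exact ENNReal.tsum_mul_left

theorem bellman_const_add (hA : s ∈ M.controlled → ∃ t, A s t) (c : ℝ≥0∞) :
    M.bellman A (fun t => c + f t) s = c + M.bellman A f s := by
  unfold bellman
  split_ifs with hs
  · obtain ⟨t, ht⟩ := hA hs
    have : Nonempty {t // A s t} := ⟨⟨t, ht⟩⟩
    rw [ENNReal.add_iSup]
  · simp_rw [mul_add]
    rw [ENNReal.tsum_add, ENNReal.tsum_mul_right, PMF.tsum_coe, one_mul]

theorem bellman_le_one (h : ∀ t, f t ≤ 1) : M.bellman A f s ≤ 1 := by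
  unfold bellman
  split_ifs with hs
  · exact iSup_le fun t => h t
  · calc ∑' t, M.prob ⟨s, hs⟩ t * f t ≤ ∑' t, M.prob ⟨s, hs⟩ t * 1 :=
          ENNReal.tsum_le_tsum fun t => mul_le_mul_right (h t) _
      _ = 1 := by simp [PMF.tsum_coe]

/-- Follows from f ≤ c + (f - c). This is the one-step form of the stopping arguments in which the
strategy may change wherever `f` is at most `c`. -/
theorem bellman_tsub_le (c : ℝ≥0∞) :
    M.bellman A f s - c ≤ M.bellman A (fun t => f t - c) s := by
  rw [tsub_le_iff_left]
  unfold bellman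
  split_ifs with hs
  · refine iSup_le fun t => (le_add_tsub (b := c)).trans ?_
    gcongr
    exact le_iSup (fun t : {t // A s t} => f t - c) t
  · calc ∑' t, M.prob ⟨s, hs⟩ t * f t
        ≤ ∑' t, (M.prob ⟨s, hs⟩ t * c + M.prob ⟨s, hs⟩ t * (f t - c)) := by
          refine ENNReal.tsum_le_tsum fun t => ?_
          rw [← mul_add]
          gcongr
          exact le_add_tsub
      _ = c + ∑' t, M.prob ⟨s, hs⟩ t * (f t - c) := by
          rw [ENNReal.tsum_add, ENNReal.tsum_mul_right, PMF.tsum_coe, one_mul]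

theorem reachWithin_of_mem (h : s ∈ G) (n : ℕ) : M.reachWithin A G n s = 1 := by
  cases n <;> simp [reachWithin, h]

theorem reachWithin_zero_of_notMem (h : s ∉ G) : M.reachWithin A G 0 s = 0 := by
  simp [reachWithin, h]

theorem reachWithin_succ_of_notMem (h : s ∉ G) (n : ℕ) :
    M.reachWithin A G (n + 1) s = M.bellman A (M.reachWithin A G n) s := by
  simp [reachWithin, h]

theorem reachWithin_le_succ (n : ℕ) (s : S) :
    M.reachWithin A G n s ≤ M.reachWithin A G (n + 1) s := by
  induction n generalizing s with
  | zero =>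
    by_cases h : s ∈ G
    · simp [reachWithin_of_mem h]
    · simp [reachWithin_zero_of_notMem h]
  | succ n ih =>
    by_cases h : s ∈ G
    · simp [reachWithin_of_mem h]
    · rw [reachWithin_succ_of_notMem h, reachWithin_succ_of_notMem h]
      exact bellman_mono ih

theorem reachWithin_mono : Monotone (M.reachWithin A G) :=
  monotone_nat_of_le_succ fun n s => reachWithin_le_succ n s

theorem reachWithin_le_one (n : ℕ) (s : S) : M.reachWithin A G n s ≤ 1 := by
  induction n generalizing s with
  | zero =>
    by_cases h : s ∈ G
    · simp [reachWithin_of_mem h]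
    · simp [reachWithin_zero_of_notMem h]
  | succ n ih =>
    by_cases h : s ∈ G
    · simp [reachWithin_of_mem h]
    · rw [reachWithin_succ_of_notMem h]
      exact bellman_le_one ih

theorem reachWithin_le_reachSup (n : ℕ) (s : S) : M.reachWithin A G n s ≤ M.reachSup A G s :=
  le_iSup (fun n => M.reachWithin A G n s) n

theorem reachSup_le_one (s : S) : M.reachSup A G s ≤ 1 :=
  iSup_le fun n => reachWithin_le_one n s

theorem reachSup_of_mem (h : s ∈ G) : M.reachSup A G s = 1 := by
  simp [reachSup, reachWithin_of_mem h]

theorem reachSup_of_notMem (h : s ∉ G) :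
    M.reachSup A G s = M.bellman A (M.reachSup A G) s := by
  have : M.reachSup A G = fun t => ⨆ n, M.reachWithin A G n t := rfl
  rw [this, bellman_iSup reachWithin_mono]
  simp_rw [← reachWithin_succ_of_notMem h]
  exact (Monotone.iSup_nat_add (f := fun n => M.reachWithin A G n s)
    (fun m n hmn => reachWithin_mono hmn s) 1).symm

theorem reachSup_mono_rel (h : ∀ s ∈ M.controlled, ∀ t, A s t → B s t) (s : S) :
    M.reachSup A G s ≤ M.reachSup B G s := by
  refine iSup_mono fun n => ?_
  induction n generalizing s with
  | zero => exact le_rfl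
  | succ n ih =>
    by_cases hs : s ∈ G
    · simp [reachWithin_of_mem hs]
    · rw [reachWithin_succ_of_notMem hs, reachWithin_succ_of_notMem hs]
      exact (bellman_mono ih).trans (bellman_mono_rel (h s))

theorem reachSup_mono_set (h : G ⊆ H) (s : S) : M.reachSup A G s ≤ M.reachSup A H s := by
  refine iSup_mono fun n => ?_
  induction n generalizing s with
  | zero =>
    by_cases hs : s ∈ G
    · simp [reachWithin_of_mem (h hs), reachWithin_of_mem hs]
    · simp [reachWithin_zero_of_notMem hs]
  | succ n ih =>
    by_cases hs : s ∈ H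
    · rw [reachWithin_of_mem hs]
      exact reachWithin_le_one _ _
    · rw [reachWithin_succ_of_notMem hs, reachWithin_succ_of_notMem fun hG => hs (h hG)]
      exact bellman_mono ih

/-- If the values of a reachability objective are bounded away from zero, they are one. -/
theorem reachSup_eq_one (hA : ∀ s ∈ M.controlled, ∃ t, A s t) {c : ℝ≥0∞} (hc : c ≠ 0)
    (h : ∀ s, c ≤ M.reachSup A G s) (s : S) : M.reachSup A G s = 1 := by
  have hc1 : c ≤ 1 := (h s).trans (reachSup_le_one s)
  -- The left side pays 1 if `G` is reached within `n` steps and `c` otherwise; `c` is still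
  -- guaranteed after a failure. In the limit r ≥ c + (1 - c) r, which forces r = 1.
  have key : ∀ n s, c + (1 - c) * M.reachWithin A G n s ≤ M.reachSup A G s := by
    intro n
    induction n with
    | zero =>
      intro s
      by_cases hs : s ∈ G
      · rw [reachWithin_of_mem hs, mul_one, reachSup_of_mem hs, add_tsub_cancel_of_le hc1]
      · rw [reachWithin_zero_of_notMem hs, mul_zero, add_zero]
        exact h s
    | succ n ih =>
      intro s
      by_cases hs : s ∈ G
      · rw [reachWithin_of_mem hs, mul_one, reachSup_of_mem hs, add_tsub_cancel_of_le hc1]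
      · rw [reachWithin_succ_of_notMem hs, reachSup_of_notMem hs, ← bellman_const_mul,
          ← bellman_const_add (hA s)]
        exact bellman_mono ih
  have hsup : c + (1 - c) * M.reachSup A G s ≤ M.reachSup A G s := by
    conv_lhs => rw [reachSup, ENNReal.mul_iSup, ENNReal.add_iSup]
    exact iSup_le fun n => key n s
  have hfin : M.reachSup A G s ≠ ∞ := ne_top_of_le_ne_top ENNReal.one_ne_top (reachSup_le_one s)
  have hcfin : c ≠ ∞ := ne_top_of_le_ne_top ENNReal.one_ne_top hc1
  refine le_antisymm (reachSup_le_one s) ?_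
  set r := M.reachSup A G s
  have hr : r = c * r + (1 - c) * r := by rw [← add_mul, add_tsub_cancel_of_le hc1, one_mul]
  have h2 : c ≤ c * r := by
    have h3 : c + (1 - c) * r ≤ c * r + (1 - c) * r := by rwa [← hr]
    exact (ENNReal.add_le_add_iff_right
      (ENNReal.mul_ne_top (ne_top_of_le_ne_top ENNReal.one_ne_top tsub_le_self) hfin)).1 h3
  by_contra! hlt
  have := ENNReal.mul_lt_mul_right hc hcfin hlt
  rw [mul_one] at this
  exact absurd h2 (not_le.2 this)

/-! ### Memoryless strategies for almost sure reachability -/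

/-- The restriction `A`, with the choices in `R` fixed to those of `g`. -/
def fixOn (A : S → S → Prop) (R : Set S) (g : S → S) : S → S → Prop :=
  fun s t => A s t ∧ (s ∈ R → t = g s)

theorem exists_fixOn (hA : ∀ s ∈ M.controlled, ∃ t, A s t) (hg : ∀ s ∈ M.controlled, A s (g s)) :
    ∀ s ∈ M.controlled, ∃ t, fixOn A R g s t := by
  intro s hs
  by_cases hR : s ∈ R
  · exact ⟨g s, hg s hs, fun _ => rfl⟩
  · obtain ⟨t, ht⟩ := hA s hs
    exact ⟨t, ht, fun h => absurd h hR⟩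

/-- Fixing a memoryless strategy on a set of states from which it reaches `G` with a probability
that is bounded away from zero preserves the reachability of `G`. -/
theorem reachSup_fixOn (hA : ∀ s ∈ M.controlled, ∃ t, A s t)
    (hg : ∀ s ∈ M.controlled, A s (g s)) {c : ℝ≥0∞} (hc : c ≠ 0) (hc1 : c ≤ 1)
    (hR : ∀ s ∈ R, c ≤ M.reachSup (graph g) G s) (hreach : ∀ s, M.reachSup A (R ∪ G) s = 1)
    (s : S) : M.reachSup (fixOn A R g) G s = 1 := by
  refine reachSup_eq_one (exists_fixOn hA hg) hc (fun s => ?_) s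
  have hmem : ∀ s ∈ R ∪ G, c ≤ M.reachSup (fixOn A R g) G s := by
    rintro s (hs | hs)
    · refine (hR s hs).trans (reachSup_mono_rel (fun t ht u hu => ?_) s)
      cases hu
      exact ⟨hg t ht, fun _ => rfl⟩
    · rw [reachSup_of_mem hs]
      exact hc1
  -- Until `R ∪ G` is reached the new restriction is inactive; from there `G` is reached with
  -- probability at least `c`.
  have key : ∀ n s, c * M.reachWithin A (R ∪ G) n s ≤ M.reachSup (fixOn A R g) G s := by
    intro n
    induction n with
    | zero =>
      intro s
      by_cases hs : s ∈ R ∪ G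
      · rw [reachWithin_of_mem hs, mul_one]
        exact hmem s hs
      · rw [reachWithin_zero_of_notMem hs, mul_zero]
        exact zero_le
    | succ n ih =>
      intro s
      by_cases hs : s ∈ R ∪ G
      · rw [reachWithin_of_mem hs, mul_one]
        exact hmem s hs
      · rw [reachWithin_succ_of_notMem hs, reachSup_of_notMem fun h => hs (Or.inr h),
          ← bellman_const_mul]
        exact (bellman_mono ih).trans
          (bellman_mono_rel fun _ t ht => ⟨ht, fun h => absurd (Or.inl h) hs⟩)
  rw [← mul_one c, ← hreach s, reachSup, ENNReal.mul_iSup]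
  exact iSup_le fun n => key n s

/-- A memoryless strategy that agrees with `g` where `g` reaches `G` with probability more than `c`
loses at most `c`. -/
theorem reachSup_graph_tsub_le {g' : S → S} {c : ℝ≥0∞}
    (h : ∀ s ∈ M.controlled, c < M.reachSup (graph g) G s → g' s = g s) (s : S) :
    M.reachSup (graph g) G s - c ≤ M.reachSup (graph g') G s := by
  -- Where `g` succeeds with probability at most `c` the truncated difference is zero; elsewhere the
  -- two strategies make the same move.
  have key : ∀ n s, M.reachWithin (graph g) G n s - c ≤ M.reachWithin (graph g') G n s := by
    intro n
    induction n with
    | zero => exact fun s => tsub_le_self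
    | succ n ih =>
      intro s
      by_cases hs : s ∈ G
      · rw [reachWithin_of_mem hs, reachWithin_of_mem hs]
        exact tsub_le_self
      by_cases hlt : c < M.reachSup (graph g) G s
      · rw [reachWithin_succ_of_notMem hs, reachWithin_succ_of_notMem hs,
          bellman_graph_congr (g := g') fun hC => h s hC hlt]
        exact (bellman_tsub_le c).trans (bellman_mono ih)
      · rw [tsub_eq_zero_of_le ((reachWithin_le_reachSup _ s).trans (not_lt.1 hlt))]
        exact zero_le
  rw [tsub_le_iff_right]
  refine iSup_le fun n => ?_
  rw [← tsub_le_iff_right]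
  exact (key n s).trans (reachWithin_le_reachSup n s)

/-- Reachability from a single state: a memoryless strategy that is greedy for the discounted
value. -/
theorem exists_graph_lt_reachSup (hA : ∀ s ∈ M.controlled, ∃ t, A s t) {a : ℝ≥0∞} {s₀ : S}
    (h : a < M.reachSup A G s₀) :
    ∃ g : S → S, (∀ s ∈ M.controlled, A s (g s)) ∧ a < M.reachSup (graph g) G s₀ := by
  obtain ⟨N, hN⟩ := lt_iSup_iff.1 h
  -- The discount `l` is so close to 1 that the bound `a` survives at horizon `N`. The gap between
  -- `l` and the later `m` pays for suprema that are not attained.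
  obtain ⟨l, hl1, hlN⟩ : ∃ l : ℝ≥0∞, l < 1 ∧ a < l ^ N * M.reachWithin A G N s₀ := by
    have hcont : Continuous fun l : ℝ≥0∞ => l ^ N * M.reachWithin A G N s₀ :=
      ENNReal.continuous_mul_const
        (ne_top_of_le_ne_top ENNReal.one_ne_top (reachWithin_le_one N s₀)) |>.comp
        (ENNReal.continuous_pow N)
    have hev : ∀ᶠ l in nhds (1 : ℝ≥0∞), a < l ^ N * M.reachWithin A G N s₀ :=
      hcont.continuousAt.eventually_const_lt (by simpa using hN)
    have hne : (nhdsWithin (1 : ℝ≥0∞) (Set.Iio 1)).NeBot :=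
      nhdsLT_neBot_of_exists_lt ⟨0, zero_lt_one⟩
    have hlt : ∀ᶠ l in nhdsWithin (1 : ℝ≥0∞) (Set.Iio 1), l < 1 := self_mem_nhdsWithin
    obtain ⟨l, hl⟩ := ((hev.filter_mono nhdsWithin_le_nhds).and hlt).exists
    exact ⟨l, hl.2, hl.1⟩
  obtain ⟨m, hlm, hm1⟩ := exists_between hl1
  let f : S → ℝ≥0∞ := fun s => ⨆ n, l ^ n * M.reachWithin A G n s
  have hf1 : ∀ s, f s ≤ 1 := fun s => iSup_le fun n =>
    mul_le_one' (pow_le_one' hl1.le n) (reachWithin_le_one n s)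
  have hfT : ∀ s ∉ G, f s ≤ l * M.bellman A f s := by
    intro s hs
    refine iSup_le fun n => ?_
    cases n with
    | zero =>
      rw [reachWithin_zero_of_notMem hs, mul_zero]
      exact zero_le
    | succ n =>
      rw [reachWithin_succ_of_notMem hs, pow_succ', mul_assoc, ← bellman_const_mul]
      gcongr
      exact bellman_mono fun t => le_iSup (fun n => l ^ n * M.reachWithin A G n t) n
  have hex : ∀ s, ∃ t, s ∈ M.controlled → A s t ∧ (s ∉ G → f s ≤ m * f t) := by
    intro s
    by_cases hs : s ∈ M.controlled
    swap
    · exact ⟨s, fun h => absurd h hs⟩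
    by_cases hsG : s ∈ G
    · obtain ⟨t, ht⟩ := hA s hs
      exact ⟨t, fun _ => ⟨ht, fun h => absurd hsG h⟩⟩
    by_cases hf0 : f s = 0
    · obtain ⟨t, ht⟩ := hA s hs
      exact ⟨t, fun _ => ⟨ht, fun _ => by simp [hf0]⟩⟩
    -- Without such a successor, m · b ≤ f s ≤ l · b for the positive and finite Bellman value b,
    -- against l < m.
    by_contra! hcon
    have hle : m * M.bellman A f s ≤ f s := by
      rw [bellman, dif_pos hs, ENNReal.mul_iSup]
      exact iSup_le fun t => ((hcon t).2 t.2).2.le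
    have hb0 : M.bellman A f s ≠ 0 := by
      intro hb
      exact hf0 (le_antisymm (by simpa [hb] using hfT s hsG) zero_le)
    have hbt : M.bellman A f s ≠ ∞ :=
      ne_top_of_le_ne_top ENNReal.one_ne_top (bellman_le_one hf1)
    exact absurd (hle.trans (hfT s hsG)) (not_le.2 (ENNReal.mul_lt_mul_left hb0 hbt hlm))
  choose g hg using hex
  refine ⟨g, fun s hs => (hg s hs).1, ?_⟩
  have hstep : ∀ s ∉ G, f s ≤ m * M.bellman (graph g) f s := by
    intro s hs
    by_cases hC : s ∈ M.controlled
    · rw [bellman_graph_of_controlled hC]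
      exact (hg s hC).2 hs
    · refine (hfT s hs).trans ?_
      gcongr
      exact bellman_mono_rel fun h => absurd h hC
  -- Each step outside `G` gains a factor `m`, so runs that miss `G` for `n` steps contribute at
  -- most m ^ n.
  have hind : ∀ n s, f s ≤ m ^ n + M.reachWithin (graph g) G n s := by
    intro n
    induction n with
    | zero =>
      intro s
      rw [pow_zero]
      exact (hf1 s).trans le_self_add
    | succ n ih =>
      intro s
      by_cases hs : s ∈ G
      · rw [reachWithin_of_mem hs]
        exact (hf1 s).trans le_add_self
      · rw [reachWithin_succ_of_notMem hs]
        calc f s ≤ m * M.bellman (graph g) f s := hstep s hs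
          _ ≤ m * M.bellman (graph g) (fun t => m ^ n + M.reachWithin (graph g) G n t) s := by
              gcongr
              exact bellman_mono ih
          _ = m ^ (n + 1) + m * M.bellman (graph g) (M.reachWithin (graph g) G n) s := by
              rw [bellman_const_add (A := graph g) fun _ => ⟨g s, rfl⟩, mul_add, pow_succ']
          _ ≤ m ^ (n + 1) + M.bellman (graph g) (M.reachWithin (graph g) G n) s := by
              gcongr
              exact mul_le_of_le_one_left' hm1.le
  have hlim : f s₀ ≤ M.reachSup (graph g) G s₀ := by
    have ht : Tendsto (fun n => m ^ n + M.reachSup (graph g) G s₀) atTop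
        (nhds (0 + M.reachSup (graph g) G s₀)) :=
      (ENNReal.tendsto_pow_atTop_nhds_zero_iff.2 hm1).add tendsto_const_nhds
    rw [zero_add] at ht
    refine ge_of_tendsto' ht fun n => (hind n s₀).trans ?_
    gcongr
    exact reachWithin_le_reachSup n s₀
  exact hlN.trans_le ((le_iSup (fun n => l ^ n * M.reachWithin A G n s₀) N).trans hlim)

/-- The restrictions under which `G` is reached almost surely from everywhere. -/
def IsReaching (M : MDP S) (G : Set S) (A : S → S → Prop) : Prop :=
  (∀ s ∈ M.controlled, ∃ t, A s t) ∧ ∀ s, M.reachSup A G s = 1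

/-- One stage of the construction. Some `g` reaches `G` from `s` with probability above 2/3 and is
frozen where it succeeds with probability at least 1/3; strategies that respect this lose at most
1/3 from `s`. -/
theorem IsReaching.exists_fix (h : M.IsReaching G A) (s : S) :
    ∃ B, M.IsReaching G B ∧ (∀ u t, B u t → A u t) ∧ (∀ t t', B s t → B s t' → t = t') ∧
      ∀ g' : S → S, (∀ u ∈ M.controlled, B u (g' u)) →
        (3 : ℝ≥0∞)⁻¹ ≤ M.reachSup (graph g') G s := by
  obtain ⟨g, hg, hlt⟩ := exists_graph_lt_reachSup h.1
    (inv_three_add_inv_three_lt_one.trans_eq (h.2 s).symm)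
  let R : Set S := {u | (3 : ℝ≥0∞)⁻¹ ≤ M.reachSup (graph g) G u}
  have hsR : s ∈ R := le_self_add.trans hlt.le
  refine ⟨fixOn A R g, ⟨exists_fixOn h.1 hg, fun u => ?_⟩, fun u t hut => hut.1,
    fun t t' ht ht' => (ht.2 hsR).trans (ht'.2 hsR).symm, fun g' hg' => ?_⟩
  · refine reachSup_fixOn h.1 hg (c := 3⁻¹) (by simp) (by simp) (fun u hu => hu) (fun u => ?_) u
    exact le_antisymm (reachSup_le_one u)
      ((h.2 u).ge.trans (reachSup_mono_set Set.subset_union_right u))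
  · refine le_trans ?_ (reachSup_graph_tsub_le (g := g) (c := 3⁻¹)
      (fun u hu huc => (hg' u hu).2 huc.le) s)
    exact ENNReal.le_sub_of_add_le_right (by simp) hlt.le

/-- If `G` can be reached almost surely from everywhere, then this is done by a single memoryless
strategy. -/
theorem IsReaching.exists_graph [Countable S] (h : M.IsReaching G A) :
    ∃ g : S → S, (∀ s ∈ M.controlled, A s (g s)) ∧ ∀ s, M.reachSup (graph g) G s = 1 := by
  rcases isEmpty_or_nonempty S with hS | hS
  · exact ⟨id, fun s => hS.elim s, fun s => hS.elim s⟩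
  obtain ⟨e, he⟩ := exists_surjective_nat S
  choose F hF using fun (B : {B // M.IsReaching G B}) s => B.2.exists_fix s
  let seq : ℕ → {B // M.IsReaching G B} :=
    Nat.rec ⟨A, h⟩ fun n B => ⟨F B (e n), (hF B (e n)).1⟩
  have hanti : ∀ m n, m ≤ n → ∀ u t, (seq n).1 u t → (seq m).1 u t := by
    intro m n hmn
    induction n, hmn using Nat.le_induction with
    | base => exact fun u t h => h
    | succ n _ ih => exact fun u t hut => ih u t ((hF (seq n) (e n)).2.1 u t hut)
  choose i hi using he
  have hex : ∀ s, ∃ t, s ∈ M.controlled → (seq (i s + 1)).1 s t := by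
    intro s
    by_cases hs : s ∈ M.controlled
    · obtain ⟨t, ht⟩ := (seq (i s + 1)).2.1 s hs
      exact ⟨t, fun _ => ht⟩
    · exact ⟨s, fun h => absurd h hs⟩
  choose g hg using hex
  -- Up to stage `i s + 1` the restrictions are weaker. Afterwards the choice at `s` is unique, and
  -- since some choice always remains, it is `g s`.
  have hall : ∀ m, ∀ s ∈ M.controlled, (seq m).1 s (g s) := by
    intro m s hs
    rcases le_total m (i s + 1) with hm | hm
    · exact hanti _ _ hm _ _ (hg s hs)
    · obtain ⟨t, ht⟩ := (seq m).2.1 s hs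
      have huniq := (hF (seq (i s)) (e (i s))).2.2.1
      rw [hi s] at huniq
      have hg' : F (seq (i s)) s s (g s) := by
        have := hg s hs
        change F (seq (i s)) (e (i s)) s (g s) at this
        rwa [hi s] at this
      have ht' : F (seq (i s)) s s t := by
        have := hanti _ _ hm _ _ ht
        change F (seq (i s)) (e (i s)) s t at this
        rwa [hi s] at this
      rw [huniq _ _ hg' ht']
      exact ht
  refine ⟨g, hall 0, fun s => reachSup_eq_one (A := graph g) (fun s _ => ⟨g s, rfl⟩) (c := 3⁻¹)
    (by simp) (fun s => ?_) s⟩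
  have := (hF (seq (i s)) (e (i s))).2.2.2 g (hall (i s + 1))
  rwa [hi s] at this

end Bellman

/-! ### Strategies against the one-step operator -/

section AlmostSure

variable {S : Type*} {M : MDP S}

open Classical in
/-- The choices of an MD strategy, extended to all states. -/
noncomputable def MDStrategy.choice (σ : M.MDStrategy) (s : S) : S :=
  if h : s ∈ M.controlled then σ.next ⟨s, h⟩ else s

/-- The MD strategy that chooses by `g`. -/
def MDStrategy.ofChoice (g : S → S) (hg : ∀ s ∈ M.controlled, M.trans s (g s)) : M.MDStrategy where
  next := fun s => g s
  trans_next := fun s => hg s s.2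

theorem MDStrategy.trans_choice (σ : M.MDStrategy) : ∀ s ∈ M.controlled, M.trans s (σ.choice s) := by
  intro s hs
  rw [choice, dif_pos hs]
  exact σ.trans_next ⟨s, hs⟩

theorem MDStrategy.choice_ofChoice {g : S → S} (hg : ∀ s ∈ M.controlled, M.trans s (g s)) {s : S}
    (hs : s ∈ M.controlled) : (ofChoice g hg).choice s = g s := by
  rw [choice, dif_pos hs]
  rfl

theorem MDStrategy.tsum_step (σ : M.MDStrategy) (w : List S) (s : S) (f : S → ℝ≥0∞) :
    ∑' t, σ.toStrategy.step w s t * f t = M.bellman (graph σ.choice) f s := by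
  by_cases hs : s ∈ M.controlled
  · have hstep : σ.toStrategy.step w s = PMF.pure (σ.choice s) := by
      simp [Strategy.step, hs, toStrategy, choice]
    rw [hstep, bellman_graph_of_controlled hs,
      tsum_eq_single (σ.choice s) fun t ht => by simp [PMF.pure_apply, ht]]
    simp
  · simp [Strategy.step, bellman, hs]

/-- An average over permitted successors is at most their supremum, so randomization does not beat
the one-step operator. -/
theorem Strategy.tsum_step_le (τ : M.Strategy) {A : S → S → Prop}
    (hA : ∀ w (s : {s : S // s ∈ M.controlled}) t, τ.act w s t ≠ 0 → A s t) (w : List S) (s : S)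
    (f : S → ℝ≥0∞) : ∑' t, τ.step w s t * f t ≤ M.bellman A f s := by
  by_cases hs : s ∈ M.controlled
  · rw [bellman, dif_pos hs]
    calc ∑' t, τ.step w s t * f t ≤ ∑' t, τ.step w s t * ⨆ t : {t // A s t}, f t := by
          refine ENNReal.tsum_le_tsum fun t => ?_
          by_cases ht : τ.step w s t = 0
          · simp [ht]
          · gcongr
            rw [Strategy.step, dif_pos hs] at ht
            exact le_iSup (fun t : {t // A s t} => f t) ⟨t, hA w ⟨s, hs⟩ t ht⟩
      _ = ⨆ t : {t // A s t}, f t := by rw [ENNReal.tsum_mul_right, PMF.tsum_coe, one_mul]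
  · simp [Strategy.step, bellman, hs]

variable [Countable S] [MeasurableSpace S] [MeasurableSingletonClass S]

theorem measurableSet_exists_le_mem (G : Set S) (n : ℕ) :
    MeasurableSet {ρ : ℕ → S | ∃ k ≤ n, ρ k ∈ G} := by
  have : {ρ : ℕ → S | ∃ k ≤ n, ρ k ∈ G} = ⋃ k, ⋃ _ : k ≤ n, (fun ρ : ℕ → S => ρ k) ⁻¹' G := by
    ext ρ
    simp
  rw [this]
  exact MeasurableSet.iUnion fun k => MeasurableSet.iUnion fun _ =>
    measurable_pi_apply k MeasurableSet.of_discrete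

theorem Strategy.runMeasure_exists_le_mem_le {A : S → S → Prop} (G : Set S) (n : ℕ)
    (τ : M.Strategy) (hA : ∀ w (s : {s : S // s ∈ M.controlled}) t, τ.act w s t ≠ 0 → A s t)
    (s : S) : τ.runMeasure s {ρ | ∃ k ≤ n, ρ k ∈ G} ≤ M.reachWithin A G n s := by
  induction n generalizing τ s with
  | zero =>
    by_cases hs : s ∈ G
    · rw [reachWithin_of_mem hs]
      exact prob_le_one
    · rw [τ.runMeasure_eq_zero s (measurableSet_exists_le_mem G 0)]
      · exact zero_le
      · rintro ρ ⟨k, hk, hρ⟩ h0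
        rw [Nat.le_zero.1 hk, h0] at hρ
        exact hs hρ
  | succ n ih =>
    have : Nonempty S := ⟨s⟩
    by_cases hs : s ∈ G
    · rw [reachWithin_of_mem hs]
      exact prob_le_one
    rw [reachWithin_succ_of_notMem hs, τ.runMeasure_step s (measurableSet_exists_le_mem G _)]
    have hpre : seqCons s ⁻¹' {ρ | ∃ k ≤ n + 1, ρ k ∈ G} = {ρ | ∃ k ≤ n, ρ k ∈ G} := by
      ext ρ
      constructor
      · rintro ⟨k, hk, hρ⟩
        cases k with
        | zero => exact absurd hρ hs
        | succ k => exact ⟨k, by omega, hρ⟩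
      · rintro ⟨k, hk, hρ⟩
        exact ⟨k + 1, by omega, hρ⟩
    rw [hpre]
    exact (τ.tsum_step_le hA [] s _).trans
      (bellman_mono fun t => ih (τ.shift s) (fun w u v h => hA _ u v h) t)

theorem Strategy.runMeasure_exists_mem_le {A : S → S → Prop} (G : Set S) (τ : M.Strategy)
    (hA : ∀ w (s : {s : S // s ∈ M.controlled}) t, τ.act w s t ≠ 0 → A s t) (s : S) :
    τ.runMeasure s {ρ | ∃ k, ρ k ∈ G} ≤ M.reachSup A G s := by
  have hU : {ρ : ℕ → S | ∃ k, ρ k ∈ G} = ⋃ n, {ρ | ∃ k ≤ n, ρ k ∈ G} := by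
    ext ρ
    simp only [Set.mem_iUnion]
    exact ⟨fun ⟨k, hk⟩ => ⟨k, k, le_rfl, hk⟩, fun ⟨_, k, _, hk⟩ => ⟨k, hk⟩⟩
  have hmono : Monotone fun n => {ρ : ℕ → S | ∃ k ≤ n, ρ k ∈ G} :=
    fun m n hmn ρ ⟨k, hk, hρ⟩ => ⟨k, hk.trans hmn, hρ⟩
  rw [hU, hmono.measure_iUnion]
  exact iSup_mono fun n => τ.runMeasure_exists_le_mem_le G n hA s

theorem MDStrategy.act_toStrategy_ne_zero (σ : M.MDStrategy) (w : List S)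
    (s : {s : S // s ∈ M.controlled}) (t : S) (h : σ.toStrategy.act w s t ≠ 0) :
    graph σ.choice s t := by
  have : t = σ.next s := by
    by_contra hne
    exact h (by simp [toStrategy, PMF.pure_apply, hne])
  rw [graph, choice, dif_pos s.2]
  exact this

theorem MDStrategy.runMeasure_step (σ : M.MDStrategy) (s : S) {A : Set (ℕ → S)}
    (hA : MeasurableSet A) : σ.toStrategy.runMeasure s A =
      M.bellman (graph σ.choice) (fun t => σ.toStrategy.runMeasure t (seqCons s ⁻¹' A)) s := by
  have : Nonempty S := ⟨s⟩
  rw [σ.toStrategy.runMeasure_step s hA]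
  exact σ.tsum_step [] s _

theorem preimage_seqCons_safety {T : Set S} {s : S} (hs : s ∉ T) :
    seqCons s ⁻¹' safety T = safety T := by
  ext ρ
  refine ⟨mem_safety_of_seqCons, fun h n => ?_⟩
  cases n with
  | zero => exact hs
  | succ n => exact h n

theorem Strategy.runMeasure_safety_of_mem (τ : M.Strategy) {T : Set S} {s : S} (hs : s ∈ T) :
    τ.runMeasure s (safety T) = 0 :=
  τ.runMeasure_eq_zero s (measurableSet_safety T) fun ρ hρ h => hρ 0 (by rwa [h])

/-- An MD strategy that agrees with `σ` where `σ` is safe with probability at least `c` stays among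
these states with a probability that is at most `c` smaller than the safety probability of `σ`. -/
theorem MDStrategy.tsub_le_runMeasure_safety (σ σ' : M.MDStrategy) (T : Set S) {c : ℝ≥0∞}
    (hc : c ≠ 0)
    (h : ∀ s ∈ M.controlled, c ≤ σ.toStrategy.runMeasure s (safety T) →
      σ'.choice s = σ.choice s) (s : S) :
    σ.toStrategy.runMeasure s (safety T) - c ≤
      σ'.toStrategy.runMeasure s (safety {t | σ.toStrategy.runMeasure t (safety T) < c}) := by
  set u : S → ℝ≥0∞ := fun t => σ.toStrategy.runMeasure t (safety T) with hu
  have hm : ∀ n, MeasurableSet {ρ : ℕ → S | ∀ k ≤ n, c ≤ u (ρ k)} := by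
    intro n
    have : {ρ : ℕ → S | ∀ k ≤ n, c ≤ u (ρ k)} = {ρ | ∃ k ≤ n, ρ k ∈ {t | u t < c}}ᶜ := by
      ext ρ
      simp
    rw [this]
    exact (measurableSet_exists_le_mem _ n).compl
  -- While c ≤ u, the state is outside `T`, so `u` equals its one-step average under `σ`, which `σ'`
  -- copies; where u < c the left side vanishes.
  have key : ∀ n s, u s - c ≤ σ'.toStrategy.runMeasure s {ρ | ∀ k ≤ n, c ≤ u (ρ k)} := by
    intro n
    induction n with
    | zero =>
      intro s
      by_cases hs : c ≤ u s
      · rw [σ'.toStrategy.runMeasure_eq_one s (hm 0)]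
        · exact tsub_le_self.trans prob_le_one
        · intro ρ hρ k hk
          rw [Nat.le_zero.1 hk, hρ]
          exact hs
      · rw [tsub_eq_zero_of_le (not_le.1 hs).le]
        exact zero_le
    | succ n ih =>
      intro s
      by_cases hs : c ≤ u s
      · have hsT : s ∉ T := by
          intro hsT
          rw [hu] at hs
          simp only [σ.toStrategy.runMeasure_safety_of_mem hsT] at hs
          exact hc (le_antisymm hs zero_le)
        have hpre : seqCons s ⁻¹' {ρ | ∀ k ≤ n + 1, c ≤ u (ρ k)} =
            {ρ | ∀ k ≤ n, c ≤ u (ρ k)} := by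
          ext ρ
          constructor
          · exact fun h k hk => h (k + 1) (by omega)
          · intro h k hk
            cases k with
            | zero => exact hs
            | succ k => exact h k (by omega)
        have hus : u s = M.bellman (graph σ.choice) u s := by
          rw [hu]
          simp only
          rw [σ.runMeasure_step s (measurableSet_safety T), preimage_seqCons_safety hsT]
        rw [σ'.runMeasure_step s (hm _), hpre, hus,
          bellman_graph_congr (g' := σ'.choice) fun hC => (h s hC hs).symm]
        exact (bellman_tsub_le c).trans (bellman_mono ih)
      · rw [tsub_eq_zero_of_le (not_le.1 hs).le]
        exact zero_le
  have hI : safety {t | u t < c} = ⋂ n, {ρ : ℕ → S | ∀ k ≤ n, c ≤ u (ρ k)} := by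
    ext ρ
    simp only [safety, Set.mem_iInter, Set.mem_ofPred_eq, not_lt]
    exact ⟨fun h _ k _ => h k, fun h n => h n n le_rfl⟩
  have hanti : Antitone fun n => {ρ : ℕ → S | ∀ k ≤ n, c ≤ u (ρ k)} :=
    fun m n hmn ρ h k hk => h k (hk.trans hmn)
  rw [hI, hanti.measure_iInter (fun n => (hm n).nullMeasurableSet) ⟨0, measure_ne_top _ _⟩]
  exact le_iInf fun n => key n s

/-! ### Three-color parity when every state can win almost surely -/

theorem measurableSet_frequently_col (col : S → ℕ) (c : ℕ) :
    MeasurableSet {ρ : ℕ → S | ∃ᶠ n in atTop, col (ρ n) = c} := by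
  have : {ρ : ℕ → S | ∃ᶠ n in atTop, col (ρ n) = c} =
      ⋂ a : ℕ, ⋃ b, ⋃ _ : a ≤ b, (fun ρ : ℕ → S => ρ b) ⁻¹' {s | col s = c} := by
    ext ρ
    simp [frequently_atTop]
  rw [this]
  exact MeasurableSet.iInter fun a => MeasurableSet.iUnion fun b => MeasurableSet.iUnion fun _ =>
    measurable_pi_apply b MeasurableSet.of_discrete

theorem eventually_ne_one_of_mem_parity {S : Type*} {col : S → ℕ}
    (hcol : ∀ s, col s ∈ ({0, 1, 2} : Set ℕ)) {ρ : ℕ → S} (h : ρ ∈ parity col)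
    (h2 : ∀ n, col (ρ n) ≠ 2) : ∃ n, ∀ k, col (ρ (n + k)) ≠ 1 := by
  obtain ⟨c, hc, hfreq, hev⟩ := h
  obtain ⟨n, hn⟩ := eventually_atTop.1 hev
  have hc0 : c = 0 := by
    obtain ⟨m, hm⟩ := hfreq.exists
    rcases hcol (ρ m) with h | h | h
    · omega
    · rw [← hm, h] at hc
      exact absurd hc (by decide)
    · exact absurd h (h2 m)
  refine ⟨n, fun k => ?_⟩
  have := hn (n + k) (by omega)
  omega

/-- A losing run sees color 2 only finitely often; if it also saw color 1 only finitely often, it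
would end in color 0 and win. -/
theorem exists_shift_of_notMem_parity {S : Type*} {col : S → ℕ}
    (hcol : ∀ s, col s ∈ ({0, 1, 2} : Set ℕ)) {ρ : ℕ → S} (h : ρ ∉ parity col) :
    ∃ n, (∀ k, col (ρ (n + k)) ≠ 2) ∧ ∃ᶠ k in atTop, col (ρ (n + k)) = 1 := by
  have hle : ∀ s, col s ≤ 2 := by
    intro s
    rcases hcol s with h | h | h
    · omega
    · omega
    · exact le_of_eq h
  have h2 : ∀ᶠ n in atTop, col (ρ n) ≠ 2 := by
    by_contra hcon
    exact h ⟨2, by decide, by simpa [Filter.Frequently] using hcon, .of_forall fun n => hle _⟩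
  obtain ⟨n, hn⟩ := eventually_atTop.1 h2
  refine ⟨n, fun k => hn _ (by omega), ?_⟩
  by_contra hcon
  rw [not_frequently, eventually_atTop] at hcon
  obtain ⟨m, hm⟩ := hcon
  have h0 : ∀ k ≥ n + m, col (ρ k) = 0 := by
    intro k hk
    have e : n + (k - n) = k := by omega
    have h1 := hm (k - n) (by omega)
    rw [e] at h1
    have h2 := hn k (by omega)
    have h3 := hle (ρ k)
    omega
  refine h ⟨0, by decide, ?_, ?_⟩
  · exact (eventually_atTop.2 ⟨n + m, h0⟩).frequently
  · exact eventually_atTop.2 ⟨n + m, fun k hk => (h0 k hk).le⟩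

theorem measure_le_of_subset_union_null {Ω : Type*} [MeasurableSpace Ω] {μ : Measure Ω}
    {A B Z : Set Ω} (h : A ⊆ B ∪ Z) (hZ : μ Z = 0) : μ A ≤ μ B :=
  (measure_mono h).trans ((measure_union_le B Z).trans (by rw [hZ, add_zero]))

/-- The verification half of the argument: copying `σ` where u ≥ 1/3 and almost surely reaching `G`
already suffice to win. -/
theorem runMeasure_parity_eq_one_of_reachSup {col : S → ℕ}
    (hcol : ∀ s, col s ∈ ({0, 1, 2} : Set ℕ)) (σ σ' : M.MDStrategy)
    (hagree : ∀ s ∈ M.controlled, 3⁻¹ ≤ σ.toStrategy.runMeasure s (safety {t | col t = 1}) →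
      σ'.choice s = σ.choice s)
    (hreach : ∀ s, M.reachSup (graph σ'.choice) ({t | col t = 2} ∪
      {t | 3⁻¹ + 3⁻¹ ≤ σ.toStrategy.runMeasure t (safety {t | col t = 1})}) s = 1) (s : S) :
    σ'.toStrategy.runMeasure s (parity col) = 1 := by
  set u : S → ℝ≥0∞ := fun t => σ.toStrategy.runMeasure t (safety {t | col t = 1}) with hu
  set G : Set S := {t | col t = 2} ∪ {t | 3⁻¹ + 3⁻¹ ≤ u t} with hG
  let Z : Set (ℕ → S) := safety {t | col t = 2} ∩ {ρ | ∃ᶠ n in atTop, col (ρ n) = 1}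
  have hZm : MeasurableSet Z := (measurableSet_safety _).inter (measurableSet_frequently_col col 1)
  have hZtail : ∀ s ρ, seqCons s ρ ∈ Z → ρ ∈ Z := by
    rintro s ρ ⟨h2, h1⟩
    refine ⟨mem_safety_of_seqCons h2, ?_⟩
    change ∃ᶠ n in atTop, col (seqCons s ρ n) = 1 at h1
    rw [← map_add_atTop_eq_nat 1, frequently_map] at h1
    exact h1
  -- Color 2 excludes `Z` at once. From u ≥ 2/3, with probability at least 2/3 - 1/3 the run stays
  -- where u ≥ 1/3, hence off color 1, where u = 0.
  have hZG : ∀ s ∈ G, σ'.toStrategy.runMeasure s Z ≤ 3⁻¹ + 3⁻¹ := by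
    rintro s (hs | hs)
    · rw [σ'.toStrategy.runMeasure_eq_zero s hZm]
      · exact zero_le
      · exact fun ρ hρ h => hρ.1 0 (by rwa [h])
    · have hstay : 3⁻¹ ≤ σ'.toStrategy.runMeasure s (safety {t | u t < 3⁻¹}) := by
        refine le_trans ?_ (σ.tsub_le_runMeasure_safety σ' _ (by simp) hagree s)
        exact ENNReal.le_sub_of_add_le_right (by simp) hs
      have hdisj : Disjoint Z (safety {t | u t < 3⁻¹}) := by
        rw [Set.disjoint_left]
        rintro ρ ⟨-, h1⟩ hρ
        obtain ⟨n, hn⟩ := Filter.Frequently.exists h1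
        refine hρ n ?_
        change u (ρ n) < 3⁻¹
        rw [hu]
        simp only
        rw [σ.toStrategy.runMeasure_safety_of_mem hn]
        simp
      have hsum : σ'.toStrategy.runMeasure s Z +
          σ'.toStrategy.runMeasure s (safety {t | u t < 3⁻¹}) ≤ 1 := by
        rw [← measure_union hdisj (measurableSet_safety _)]
        exact prob_le_one
      refine (ENNReal.add_le_add_iff_right (a := (3 : ℝ≥0∞)⁻¹) (by simp)).1 ?_
      rw [ENNReal.inv_three_add_inv_three]
      exact le_trans (by gcongr) hsum
  -- Once `G` is reached, `Z` fails with probability at least 1/3, and before that `Z` passes to the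
  -- rest of the run.
  have hZn : ∀ n s, 3⁻¹ * M.reachWithin (graph σ'.choice) G n s +
      σ'.toStrategy.runMeasure s Z ≤ 1 := by
    have hmem : ∀ n, ∀ s ∈ G, 3⁻¹ * M.reachWithin (graph σ'.choice) G n s +
        σ'.toStrategy.runMeasure s Z ≤ 1 := by
      intro n s hs
      rw [reachWithin_of_mem hs, mul_one, ← ENNReal.inv_three_add_inv_three, add_assoc]
      gcongr
      exact hZG s hs
    intro n
    induction n with
    | zero =>
      intro s
      by_cases hs : s ∈ G
      · exact hmem 0 s hs
      · rw [reachWithin_zero_of_notMem hs, mul_zero, zero_add]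
        exact prob_le_one
    | succ n ih =>
      intro s
      by_cases hs : s ∈ G
      · exact hmem (n + 1) s hs
      rw [reachWithin_succ_of_notMem hs, σ'.runMeasure_step s hZm, ← σ'.tsum_step [],
        ← σ'.tsum_step [], ← ENNReal.tsum_mul_left, ← ENNReal.tsum_add]
      calc _ ≤ ∑' t, σ'.toStrategy.step [] s t * 1 := by
            refine ENNReal.tsum_le_tsum fun t => ?_
            rw [mul_left_comm, ← mul_add]
            gcongr
            refine le_trans ?_ (ih t)
            gcongr
            exact fun ρ hρ => hZtail s ρ hρ
        _ = 1 := by simp [PMF.tsum_coe]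
  have hZle : ∀ s, σ'.toStrategy.runMeasure s Z ≤ 3⁻¹ + 3⁻¹ := by
    intro s
    have h1 : 3⁻¹ * M.reachSup (graph σ'.choice) G s + σ'.toStrategy.runMeasure s Z ≤ 1 := by
      rw [reachSup, ENNReal.mul_iSup, ENNReal.iSup_add]
      exact iSup_le fun n => hZn n s
    rw [hreach s, mul_one, ← ENNReal.inv_three_add_inv_three, add_assoc] at h1
    exact (ENNReal.add_le_add_iff_left (by simp)).1 h1
  -- A memoryless strategy is its own shift, so the zero law applies to a singleton class.
  have hΓ : ∀ τ ∈ ({σ'.toStrategy} : Set M.Strategy), ∀ s, τ.shift s ∈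
      ({σ'.toStrategy} : Set M.Strategy) := by
    rintro τ rfl s
    rfl
  have h0 := Strategy.runMeasure_iUnion_shift_eq_zero hΓ hZm
    (Strategy.runMeasure_eq_zero_of_le hΓ hZm hZtail inv_three_add_inv_three_lt_one
      (by rintro τ rfl s; exact hZle s)) _ rfl s
  rw [← prob_compl_eq_zero_iff (measurableSet_parity col)]
  refine measure_mono_null (fun ρ hρ => ?_) h0
  obtain ⟨n, h2, h1⟩ := exists_shift_of_notMem_parity hcol hρ
  exact Set.mem_iUnion.2 ⟨n, h2, h1⟩

/-- If every state can satisfy the parity objective almost surely, and an MD strategy is uniformly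
`1/3`-optimal for never seeing the color `1`, then an MD strategy satisfies the parity objective
almost surely from everywhere. -/
theorem exists_mdStrategy_parity_eq_one {col : S → ℕ} (hcol : ∀ s, col s ∈ ({0, 1, 2} : Set ℕ))
    (hwin : ∀ s, ∃ τ : M.Strategy, τ.runMeasure s (parity col) = 1) (σ : M.MDStrategy)
    (hσ : σ.IsUniformlyEpsOptimal (safety {s | col s = 1}) (1 / 3)) :
    ∃ σ' : M.MDStrategy, ∀ s, σ'.toStrategy.runMeasure s (parity col) = 1 := by
  set T : Set S := {s | col s = 1} with hT
  set u : S → ℝ≥0∞ := fun t => σ.toStrategy.runMeasure t (safety T) with hu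
  set G : Set S := {t | col t = 2} ∪ {t | 3⁻¹ + 3⁻¹ ≤ u t} with hG
  let R : Set S := {t | 3⁻¹ ≤ u t}
  have hval : ∀ s, M.value (safety T) s ≤ u s + 3⁻¹ := by
    intro s
    have h := hσ s
    have h3 : ENNReal.ofReal (1 / 3) = 3⁻¹ := by
      rw [one_div, ENNReal.ofReal_inv_of_pos (by norm_num)]
      simp
    rw [Strategy.IsEpsOptimalFrom, h3, tsub_le_iff_right] at h
    exact h
  have hreach : ∀ s, M.reachSup M.trans (R ∪ G) s = 1 := by
    intro s
    obtain ⟨τ, hτ⟩ := hwin s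
    -- Here the uniform optimality of `σ` bounds all strategies: outside `R` the safety value is at
    -- most u + 1/3 < 2/3.
    have havoid : ∀ τ ∈ (Set.univ : Set M.Strategy), ∀ s,
        τ.runMeasure s (safety (T ∪ (R ∪ G))) ≤ 3⁻¹ + 3⁻¹ := by
      intro τ _ s
      by_cases hs : s ∈ R
      · rw [τ.runMeasure_safety_of_mem (Or.inr (Or.inl hs))]
        exact zero_le
      · calc τ.runMeasure s (safety (T ∪ (R ∪ G))) ≤ τ.runMeasure s (safety T) :=
              measure_mono fun ρ h n hn => h n (Or.inl hn)
          _ ≤ M.value (safety T) s := le_iSup (fun τ : M.Strategy => τ.runMeasure s (safety T)) τ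
          _ ≤ u s + 3⁻¹ := hval s
          _ ≤ 3⁻¹ + 3⁻¹ := by
              gcongr
              exact (not_le.1 hs).le
    have h0 := Strategy.runMeasure_iUnion_shift_eq_zero (fun _ _ _ => Set.mem_univ _)
      (measurableSet_safety _) (Strategy.runMeasure_eq_zero_of_le (fun _ _ _ => Set.mem_univ _)
        (measurableSet_safety _) (fun _ _ => mem_safety_of_seqCons)
        inv_three_add_inv_three_lt_one havoid) τ (Set.mem_univ _) s
    refine le_antisymm (reachSup_le_one s) ?_
    refine le_trans ?_ (τ.runMeasure_exists_mem_le (R ∪ G) (fun w u t h => τ.trans_of_act w u t h) s)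
    rw [← hτ]
    refine measure_le_of_subset_union_null (fun ρ hρ => ?_) h0
    by_cases hex : ∃ k, ρ k ∈ R ∪ G
    · exact Or.inl hex
    · right
      push Not at hex
      obtain ⟨n, hn⟩ := eventually_ne_one_of_mem_parity hcol hρ
        fun n h2 => hex n (Or.inr (Or.inl h2))
      refine Set.mem_iUnion.2 ⟨n, fun k hk => ?_⟩
      rcases hk with hk | hk
      · exact hn k hk
      · exact hex _ hk
  -- Outside `G`, u < 2/3, so by the zero law `σ` almost surely does not avoid both `T` and `G`
  -- forever.
  have hsafe : ∀ s, u s ≤ M.reachSup (graph σ.choice) G s := by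
    have hΓ : ∀ τ ∈ ({σ.toStrategy} : Set M.Strategy), ∀ s, τ.shift s ∈
        ({σ.toStrategy} : Set M.Strategy) := by
      rintro τ rfl s
      rfl
    have hle : ∀ τ ∈ ({σ.toStrategy} : Set M.Strategy), ∀ s,
        τ.runMeasure s (safety (T ∪ G)) ≤ 3⁻¹ + 3⁻¹ := by
      rintro τ rfl s
      by_cases hs : s ∈ G
      · rw [Strategy.runMeasure_safety_of_mem (T := T ∪ G) _ (Or.inr hs)]
        exact zero_le
      · have hlt : u s < 3⁻¹ + 3⁻¹ := not_le.1 fun h => hs (Or.inr h)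
        exact le_trans (measure_mono fun ρ (h : ∀ n, ρ n ∉ T ∪ G) n hn => h n (Or.inl hn)) hlt.le
    intro s
    have h0 := Strategy.runMeasure_eq_zero_of_le hΓ (measurableSet_safety _)
      (fun _ _ => mem_safety_of_seqCons) inv_three_add_inv_three_lt_one hle _ rfl s
    refine le_trans ?_ (σ.toStrategy.runMeasure_exists_mem_le G σ.act_toStrategy_ne_zero s)
    refine measure_le_of_subset_union_null (fun ρ hρ => ?_) h0
    by_cases hex : ∃ k, ρ k ∈ G
    · exact Or.inl hex
    · push Not at hex
      exact Or.inr fun n hn => hn.elim (hρ n) (hex n)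
  have htrans : ∀ s ∈ M.controlled, ∃ t, M.trans s t := fun s _ => M.exists_succ s
  have hfix : M.IsReaching G (fixOn M.trans R σ.choice) :=
    ⟨exists_fixOn htrans σ.trans_choice, fun s => reachSup_fixOn htrans σ.trans_choice (c := 3⁻¹)
      (by simp) (by simp) (fun t ht => le_trans ht (hsafe t)) hreach s⟩
  obtain ⟨g, hg, hg1⟩ := hfix.exists_graph
  let σ' : M.MDStrategy := .ofChoice g fun s hs => (hg s hs).1
  have hσ' : ∀ s ∈ M.controlled, σ'.choice s = g s := fun s hs =>
    MDStrategy.choice_ofChoice _ hs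
  refine ⟨σ', fun s => runMeasure_parity_eq_one_of_reachSup hcol σ σ' (fun t ht htu => ?_)
    (fun t => ?_) s⟩
  · rw [hσ' t ht]
    exact (hg t ht).2 htu
  · refine le_antisymm (reachSup_le_one t) ((hg1 t).ge.trans (reachSup_mono_rel ?_ t))
    intro v hv w hw
    rw [graph, hσ' v hv]
    exact hw

end AlmostSure

/-! ### Transfer between an MDP and its conditioned version -/

section Conditioned

variable {S : Type*} [Countable S] [MeasurableSpace S] [MeasurableSingletonClass S] {M : MDP S}
  {φ : Set (ℕ → S)}

theorem Strategy.runMeasure_le_value (σ : M.Strategy) (s : S) (φ : Set (ℕ → S)) :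
    σ.runMeasure s φ ≤ M.value φ s :=
  le_iSup (fun τ : M.Strategy => τ.runMeasure s φ) σ

/-- A loss at one possible successor would make the average strictly smaller than the value of `s`.
-/
theorem Strategy.IsOptimalFrom.shift {σ : M.Strategy} {s t : S} (hσ : σ.IsOptimalFrom φ s)
    (hm : MeasurableSet φ) (ht : IsTail φ) (hst : σ.step [] s t ≠ 0) :
    (σ.shift s).IsOptimalFrom φ t := by
  refine le_antisymm ((σ.shift s).runMeasure_le_value t φ) ?_
  by_contra! hlt
  have hfin : ∑' u, σ.step [] s u * (σ.shift s).runMeasure u φ ≠ ∞ := by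
    rw [← σ.runMeasure_tail s hm ht]
    exact measure_ne_top _ _
  have := ENNReal.tsum_lt_tsum hfin (g := fun u => σ.step [] s u * M.value φ u)
    (fun u => by gcongr; exact (σ.shift s).runMeasure_le_value u φ)
    (i := t) (ENNReal.mul_lt_mul_right hst (PMF.apply_ne_top _ _) hlt)
  rw [← σ.runMeasure_tail s hm ht, hσ.tsum_value hm ht, hσ] at this
  exact lt_irrefl _ this

/-- No successor of a controlled state has a larger value, so one possible successor of smaller
value would pull the average below the value of `s`. -/
theorem Strategy.IsOptimalFrom.value_eq {σ : M.Strategy} {s t : S} (hσ : σ.IsOptimalFrom φ s)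
    (hm : MeasurableSet φ) (ht : IsTail φ) (hs : s ∈ M.controlled) (hst : σ.step [] s t ≠ 0) :
    M.value φ s = M.value φ t := by
  refine le_antisymm ?_ (value_le_of_trans hm ht hs (σ.trans_of_step _ _ _ hst))
  by_contra! hlt
  have hle : ∀ u, σ.step [] s u * M.value φ u ≤ σ.step [] s u * M.value φ s := by
    intro u
    by_cases hu : σ.step [] s u = 0
    · simp [hu]
    · gcongr
      exact value_le_of_trans hm ht hs (σ.trans_of_step _ _ _ hu)
  have hfin : ∑' u, σ.step [] s u * M.value φ u ≠ ∞ := by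
    rw [hσ.tsum_value hm ht]
    exact M.value_ne_top φ s
  have := ENNReal.tsum_lt_tsum hfin hle
    (i := t) (ENNReal.mul_lt_mul_right hst (PMF.apply_ne_top _ _) hlt)
  rw [hσ.tsum_value hm ht, ENNReal.tsum_mul_right, PMF.tsum_coe, one_mul] at this
  exact lt_irrefl _ this

theorem preimage_seqCons_of_isTail {S : Type*} {φ : Set (ℕ → S)} (ht : IsTail φ) (s : S) :
    seqCons s ⁻¹' φ = φ := by
  ext ρ
  rw [Set.mem_preimage, ← ht (seqCons s ρ) 1]
  have : (fun k => seqCons s ρ (1 + k)) = ρ := by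
    funext k
    rw [add_comm]
    rfl
  rw [this]

/-- A distribution that is concentrated on `X`, as a distribution on `X`. -/
noncomputable def subtypePMF {S : Type*} (p : PMF S) (X : Set S) (h : ∀ t, p t ≠ 0 → t ∈ X) :
    PMF X :=
  ⟨fun t => p t, (Summable.hasSum_iff ENNReal.summable).2
    ((tsum_subtype_eq_of_support_subset fun t ht => h t ht).trans p.tsum_coe)⟩

open Classical in
/-- The distribution `p` of the successor of `x`, restricted to the states of the conditioned MDP
if all possible successors are successors there. -/
noncomputable def conditionedAct (hm : MeasurableSet φ) (ht : IsTail φ) (x : M.condStates φ)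
    (p : PMF S) : PMF (M.condStates φ) :=
  if h : ∀ t, p t ≠ 0 → t ∈ M.condStates φ ∧ M.value φ x = M.value φ t then
    subtypePMF p _ fun t ht => (h t ht).1
  -- This default keeps the strategy total; an optimal strategy does not need it at its first move.
  else PMF.pure ((M.conditioned φ hm ht).exists_succ x).choose

theorem conditionedAct_apply (hm : MeasurableSet φ) (ht : IsTail φ) {x : M.condStates φ}
    {p : PMF S} (h : ∀ t, p t ≠ 0 → t ∈ M.condStates φ ∧ M.value φ x = M.value φ t)
    (t : M.condStates φ) : conditionedAct hm ht x p t = p t := by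
  rw [conditionedAct, dif_pos h]
  rfl

theorem trans_of_conditionedAct (hm : MeasurableSet φ) (ht : IsTail φ) {x : M.condStates φ}
    {p : PMF S} (hp : ∀ t, p t ≠ 0 → M.trans x t) {t : M.condStates φ}
    (hne : conditionedAct hm ht x p t ≠ 0) : (M.conditioned φ hm ht).trans x t := by
  by_cases h : ∀ t, p t ≠ 0 → t ∈ M.condStates φ ∧ M.value φ x = M.value φ t
  · rw [conditionedAct_apply hm ht h] at hne
    exact ⟨hp t hne, fun _ => (h t hne).2⟩
  · rw [conditionedAct, dif_neg h] at hne
    have : t = ((M.conditioned φ hm ht).exists_succ x).choose := by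
      by_contra hcon
      exact hne (by simp [PMF.pure_apply, hcon])
    rw [this]
    exact ((M.conditioned φ hm ht).exists_succ x).choose_spec

/-- The strategy in the conditioned MDP that plays like `τ` where this is possible. -/
noncomputable def Strategy.conditioned (τ : M.Strategy) (hm : MeasurableSet φ) (ht : IsTail φ) :
    (M.conditioned φ hm ht).Strategy where
  act := fun w s => conditionedAct hm ht s.1 (τ.act (w.map Subtype.val) ⟨s.1, s.2⟩)
  trans_of_act := fun w s _ h =>
    trans_of_conditionedAct hm ht (τ.trans_of_act (w.map Subtype.val) ⟨s.1, s.2⟩) h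

theorem Strategy.conditioned_shift (τ : M.Strategy) (hm : MeasurableSet φ) (ht : IsTail φ)
    (x : M.condStates φ) :
    (τ.conditioned hm ht).shift x = (τ.shift x).conditioned hm ht := rfl

theorem value_mul_step_of_notMem (hm : MeasurableSet φ) (ht : IsTail φ) (τ : M.Strategy)
    (τ' : (M.conditioned φ hm ht).Strategy) (w : List S) (w' : List (M.condStates φ))
    (x t : M.condStates φ) (hx : (x : S) ∉ M.controlled) :
    M.value φ x * τ'.step w' x t = τ.step w x t * M.value φ t := by
  have hx' : x ∉ (M.conditioned φ hm ht).controlled := hx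
  rw [Strategy.step, Strategy.step, dif_neg hx, dif_neg hx']
  change M.value φ x * (M.prob ⟨x, hx⟩ t * (M.value φ t / M.value φ x)) = _
  rw [mul_left_comm, ENNReal.mul_div_cancel x.2.2.ne' (M.value_ne_top φ x)]

/-- Optimal moves from a controlled state preserve the value; at a random state the ratio of values
cancels. -/
theorem Strategy.IsOptimalFrom.value_mul_step {τ : M.Strategy} {x : M.condStates φ}
    (hτ : τ.IsOptimalFrom φ x) (hm : MeasurableSet φ) (ht : IsTail φ) (t : M.condStates φ) :
    M.value φ x * (τ.conditioned hm ht).step [] x t = τ.step [] x t * M.value φ t := by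
  by_cases hx : (x : S) ∈ M.controlled
  · have hx' : x ∈ (M.conditioned φ hm ht).controlled := hx
    have hstep : ∀ t, τ.step [] x t = τ.act [] ⟨x, hx⟩ t := by simp [Strategy.step, hx]
    have h : ∀ t, τ.act [] ⟨x, hx⟩ t ≠ 0 → t ∈ M.condStates φ ∧ M.value φ x = M.value φ t := by
      intro t h
      rw [← hstep] at h
      have hval := hτ.value_eq hm ht hx h
      exact ⟨⟨hτ.mem_optStates hm ht h, hval ▸ x.2.2⟩, hval⟩
    have hact : (τ.conditioned hm ht).step [] x t = τ.act [] ⟨x, hx⟩ t := by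
      rw [Strategy.step, dif_pos hx']
      exact conditionedAct_apply hm ht h t
    rw [hact, hstep, mul_comm]
    by_cases h0 : τ.act [] ⟨x, hx⟩ t = 0
    · simp [h0]
    · rw [(h t h0).2]
  · exact value_mul_step_of_notMem hm ht _ _ _ _ x t hx

theorem MDStrategy.value_mul_step (hm : MeasurableSet φ) (ht : IsTail φ) (σ : M.MDStrategy)
    (σ' : (M.conditioned φ hm ht).MDStrategy)
    (h : ∀ (x : M.condStates φ) (hx : (x : S) ∈ M.controlled), σ.next ⟨x, hx⟩ = σ'.next ⟨x, hx⟩)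
    (x t : M.condStates φ) :
    M.value φ x * σ'.toStrategy.step [] x t = σ.toStrategy.step [] x t * M.value φ t := by
  by_cases hx : (x : S) ∈ M.controlled
  · have hx' : x ∈ (M.conditioned φ hm ht).controlled := hx
    have h1 : σ.toStrategy.step [] x = PMF.pure (σ'.next ⟨x, hx'⟩ : S) := by
      rw [Strategy.step, dif_pos hx]
      change PMF.pure (σ.next ⟨x, hx⟩) = _
      rw [h x hx]
    have h2 : σ'.toStrategy.step [] x = PMF.pure (σ'.next ⟨x, hx'⟩) := by
      rw [Strategy.step, dif_pos hx']
      rfl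
    rw [h1, h2, PMF.pure_apply, PMF.pure_apply]
    by_cases htn : t = σ'.next ⟨x, hx'⟩
    · have hval : M.value φ x = M.value φ t := by
        rw [htn]
        exact (σ'.trans_next ⟨x, hx'⟩).2 hx
      simp [← htn, hval]
    · rw [if_neg htn, if_neg fun h => htn (Subtype.ext h), mul_zero, zero_mul]
  · exact value_mul_step_of_notMem hm ht _ _ _ _ x t hx

/-- A sequence in a subset of the states, as a sequence of states. -/
def seqVal {S : Type*} {X : Set S} (ρ : ℕ → X) : ℕ → S := fun n => ρ n

theorem measurable_seqVal {X : Set S} : Measurable (seqVal : (ℕ → X) → ℕ → S) :=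
  measurable_pi_lambda _ fun n => measurable_subtype_coe.comp (measurable_pi_apply n)

theorem preimage_seqCons_seqVal_cylinder {S : Type*} {X : Set S} (n : ℕ) (ω : ℕ → S) (x : X)
    (hx : ω 0 = x) : seqCons x ⁻¹' (seqVal ⁻¹' {ρ | ∀ i ≤ n + 1, ρ i = ω i}) =
      seqVal ⁻¹' {ρ | ∀ i ≤ n, ρ i = ω (i + 1)} := by
  ext ρ
  constructor
  · intro h i hi
    exact h (i + 1) (by omega)
  · intro h i hi
    cases i with
    | zero => exact hx.symm
    | succ i => exact h i (by omega)

theorem measurableSet_seqVal_cylinder {X : Set S} (n : ℕ) (ω : ℕ → S) :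
    MeasurableSet (seqVal ⁻¹' {ρ | ∀ i ≤ n, ρ i = ω i} : Set (ℕ → X)) :=
  measurable_seqVal (measurableSet_cylinder n ω)

/-- The values telescope along a path, and the value left at its end is the probability of φ from
there, since optimality persists after every possible move. -/
theorem Strategy.IsOptimalFrom.value_mul_runMeasure_cylinder (hm : MeasurableSet φ)
    (ht : IsTail φ) (n : ℕ) (ω : ℕ → S) {τ : M.Strategy} {x : M.condStates φ}
    (hτ : τ.IsOptimalFrom φ x) :
    M.value φ x * (τ.conditioned hm ht).runMeasure x (seqVal ⁻¹' {ρ | ∀ i ≤ n, ρ i = ω i}) =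
      τ.runMeasure x (φ ∩ {ρ | ∀ i ≤ n, ρ i = ω i}) := by
  have hne : ∀ (n : ℕ) (ω : ℕ → S) (x : M.condStates φ) (τ : M.Strategy), ω 0 ≠ x →
      M.value φ x * (τ.conditioned hm ht).runMeasure x (seqVal ⁻¹' {ρ | ∀ i ≤ n, ρ i = ω i}) =
        τ.runMeasure x (φ ∩ {ρ | ∀ i ≤ n, ρ i = ω i}) := by
    intro n ω x τ h0
    rw [τ.runMeasure_eq_zero _ (hm.inter (measurableSet_cylinder n ω))
      fun ρ hρ h => h0 ((hρ.2 0 (Nat.zero_le n)).symm.trans h),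
      (τ.conditioned hm ht).runMeasure_eq_zero _ (measurableSet_seqVal_cylinder n ω) fun ρ hρ h =>
        h0 ((hρ 0 (Nat.zero_le n)).symm.trans (congrArg Subtype.val h)), mul_zero]
  induction n generalizing ω τ x with
  | zero =>
    by_cases h0 : ω 0 = x
    · rw [(τ.conditioned hm ht).runMeasure_eq_one _ (measurableSet_seqVal_cylinder 0 ω)
        fun ρ hρ i hi => by
          rw [Nat.le_zero.1 hi, h0]
          exact congrArg Subtype.val hρ,
        measure_inter_conull, mul_one, hτ]
      refine τ.runMeasure_eq_zero _ (measurableSet_cylinder 0 ω).compl fun ρ hρ h => hρ ?_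
      intro i hi
      rw [Nat.le_zero.1 hi, h0, h]
    · exact hne 0 ω x τ h0
  | succ n ih =>
    by_cases h0 : ω 0 = x
    · have : Nonempty S := ⟨x⟩
      have : Nonempty (M.condStates φ) := ⟨x⟩
      have hpre := preimage_seqCons_cylinder n ω
      rw [h0] at hpre
      rw [Strategy.runMeasure_step _ _ (measurableSet_seqVal_cylinder _ ω),
        τ.runMeasure_step _ (hm.inter (measurableSet_cylinder _ ω)), Set.preimage_inter,
        preimage_seqCons_of_isTail ht, hpre, preimage_seqCons_seqVal_cylinder n ω x h0,
        ← ENNReal.tsum_mul_left]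
      rw [← tsum_subtype_eq_of_support_subset (s := M.condStates φ)]
      · refine tsum_congr fun t => ?_
        rw [← mul_assoc, hτ.value_mul_step hm ht t, mul_assoc]
        by_cases hst : τ.step [] x t = 0
        · simp [hst]
        · congr 1
          rw [τ.conditioned_shift hm ht x]
          exact ih _ (hτ.shift hm ht hst)
      -- Possible successors have optimal strategies, so one outside `condStates` has value 0 and
      -- contributes nothing.
      · intro t h
        have h' := left_ne_zero_of_mul h
        refine ⟨hτ.mem_optStates hm ht h', pos_iff_ne_zero.2 fun hv => right_ne_zero_of_mul h ?_⟩
        refine measure_mono_null Set.inter_subset_left (le_antisymm ?_ zero_le)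
        rw [← hv]
        exact (τ.shift x).runMeasure_le_value t φ
    · exact hne _ ω x τ h0

theorem Strategy.IsOptimalFrom.runMeasure_conditioned (hm : MeasurableSet φ) (ht : IsTail φ)
    {τ : M.Strategy} {x : M.condStates φ} (hτ : τ.IsOptimalFrom φ x) :
    (τ.conditioned hm ht).runMeasure x (seqVal ⁻¹' φ) = 1 := by
  have : Nonempty S := ⟨x⟩
  have hfin : IsFiniteMeasure (M.value φ x •
      ((τ.conditioned hm ht).runMeasure x).map seqVal) :=
    Measure.smul_finite _ (M.value_ne_top φ x)
  have heq : M.value φ x • ((τ.conditioned hm ht).runMeasure x).map seqVal =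
      (τ.runMeasure x).restrict φ := by
    refine ext_of_cylinder fun n ω => ?_
    rw [Measure.smul_apply, Measure.map_apply measurable_seqVal (measurableSet_cylinder n ω),
      Measure.restrict_apply (measurableSet_cylinder n ω), Set.inter_comm, smul_eq_mul]
    exact hτ.value_mul_runMeasure_cylinder hm ht n ω
  have h := congrArg (fun μ : Measure (ℕ → S) => μ φ) heq
  simp only [Measure.smul_apply, Measure.map_apply measurable_seqVal hm, smul_eq_mul,
    Measure.restrict_apply hm, Set.inter_self] at h
  rw [hτ] at h
  exact (ENNReal.mul_right_inj x.2.2.ne' (M.value_ne_top φ x)).1 (h.trans (mul_one _).symm)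

/-- The values telescope again, and the value at the end of the path is at most 1. No optimality is
assumed, and runs in `M` may leave `condStates`, so only an inequality holds. -/
theorem MDStrategy.value_mul_runMeasure_cylinder_le (hm : MeasurableSet φ) (ht : IsTail φ)
    (σ : M.MDStrategy) (σ' : (M.conditioned φ hm ht).MDStrategy)
    (h : ∀ (x : M.condStates φ) (hx : (x : S) ∈ M.controlled), σ.next ⟨x, hx⟩ = σ'.next ⟨x, hx⟩)
    (n : ℕ) (ω : ℕ → S) (x : M.condStates φ) :
    M.value φ x * σ'.toStrategy.runMeasure x (seqVal ⁻¹' {ρ | ∀ i ≤ n, ρ i = ω i}) ≤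
      σ.toStrategy.runMeasure x {ρ | ∀ i ≤ n, ρ i = ω i} := by
  by_cases h0 : ω 0 = x
  swap
  · rw [Strategy.runMeasure_eq_zero _ _ (measurableSet_seqVal_cylinder n ω) fun ρ hρ h =>
        h0 ((hρ 0 (Nat.zero_le n)).symm.trans (congrArg Subtype.val h)), mul_zero]
    exact zero_le
  induction n generalizing ω x with
  | zero =>
    rw [σ.toStrategy.runMeasure_eq_one _ (measurableSet_cylinder 0 ω) fun ρ hρ i hi => by
      rw [Nat.le_zero.1 hi, h0, hρ]]
    exact mul_le_one' (M.value_le_one φ x) prob_le_one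
  | succ n ih =>
    have : Nonempty S := ⟨x⟩
    have : Nonempty (M.condStates φ) := ⟨x⟩
    have hpre := preimage_seqCons_cylinder n ω
    rw [h0] at hpre
    rw [Strategy.runMeasure_step _ _ (measurableSet_seqVal_cylinder _ ω),
      Strategy.runMeasure_step _ _ (measurableSet_cylinder _ ω), hpre,
      preimage_seqCons_seqVal_cylinder n ω x h0, ← ENNReal.tsum_mul_left]
    refine le_trans (ENNReal.tsum_le_tsum fun t => ?_)
      (ENNReal.tsum_comp_le_tsum_of_injective Subtype.val_injective _)
    rw [← mul_assoc, σ.value_mul_step hm ht σ' h x t, mul_assoc]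
    refine mul_le_mul_right ?_ _
    by_cases h1 : ω 1 = t
    · exact ih (fun i => ω (i + 1)) t h1
    · refine le_trans (le_of_eq ?_) zero_le
      rw [Strategy.runMeasure_eq_zero _ _ (measurableSet_seqVal_cylinder n _) fun ρ hρ h =>
        h1 ((hρ 0 (Nat.zero_le n)).symm.trans (congrArg Subtype.val h)), mul_zero]

/-- An MD strategy that is almost surely winning in the conditioned MDP is optimal. -/
theorem MDStrategy.isOptimalFrom_of_conditioned (hm : MeasurableSet φ) (ht : IsTail φ)
    (σ : M.MDStrategy) (σ' : (M.conditioned φ hm ht).MDStrategy)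
    (h : ∀ (x : M.condStates φ) (hx : (x : S) ∈ M.controlled), σ.next ⟨x, hx⟩ = σ'.next ⟨x, hx⟩)
    (x : M.condStates φ) (hx : σ'.toStrategy.runMeasure x (seqVal ⁻¹' φ) = 1) :
    σ.toStrategy.IsOptimalFrom φ x := by
  refine le_antisymm (σ.toStrategy.runMeasure_le_value x φ) ?_
  have hdom : M.value φ x • (σ'.toStrategy.runMeasure x).map seqVal ≤ σ.toStrategy.runMeasure x := by
    refine measure_le_of_cylinder fun n ω => ?_
    rw [Measure.smul_apply, Measure.map_apply measurable_seqVal (measurableSet_cylinder n ω),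
      smul_eq_mul]
    exact σ.value_mul_runMeasure_cylinder_le hm ht σ' h n ω x
  have := hdom φ
  rwa [Measure.smul_apply, Measure.map_apply measurable_seqVal hm, smul_eq_mul, hx, mul_one] at this

end Conditioned

end MDP

/-! ### The main theorem -/

theorem mainTheorem5 {S : Type*} [Countable S] [MeasurableSpace S] [MeasurableSingletonClass S]
    (M : MDP S) (col : S → ℕ) (hcol : ∀ s, col s ∈ ({0, 1, 2} : Set ℕ))
    (hsafe : ∀ (T : Set (M.condStates (MDP.parity col))) (ε : ℝ), 0 < ε →
      ∃ σ : (M.conditioned (MDP.parity col) (MDP.measurableSet_parity col)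
          (MDP.isTail_parity col)).MDStrategy,
        σ.IsUniformlyEpsOptimal (MDP.safety T) ε) :
    ∃ σ : M.MDStrategy, ∀ s ∈ M.optStates (MDP.parity col),
      σ.toStrategy.IsOptimalFrom (MDP.parity col) s := by
  classical
  have hm := MDP.measurableSet_parity col
  have ht := MDP.isTail_parity col
  obtain ⟨σ₀, hσ₀⟩ := hsafe {s | col s = 1} (1 / 3) (by norm_num)
  obtain ⟨σ', hσ'⟩ := MDP.exists_mdStrategy_parity_eq_one
    (M := M.conditioned (MDP.parity col) hm ht) (col := fun x => col x) (fun x => hcol x)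
    (fun x => by
      obtain ⟨τ, hτ⟩ := x.2.1
      exact ⟨τ.conditioned hm ht, hτ.runMeasure_conditioned hm ht⟩) σ₀ hσ₀
  -- Outside `condStates` a state has value 0 or no optimal strategy, so any successor will do.
  let σ : M.MDStrategy :=
    { next := fun s => if h : (s : S) ∈ M.condStates (MDP.parity col) then
        σ'.next ⟨⟨s, h⟩, s.2⟩ else (M.exists_succ s).choose
      trans_next := fun s => by
        split_ifs with h
        · exact (σ'.trans_next ⟨⟨s, h⟩, s.2⟩).1
        · exact (M.exists_succ s).choose_spec }
  refine ⟨σ, fun s hs => ?_⟩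
  by_cases hpos : 0 < M.value (MDP.parity col) s
  · exact σ.isOptimalFrom_of_conditioned hm ht σ' (fun x hx => dif_pos x.2) ⟨s, hs, hpos⟩
      (hσ' ⟨s, hs, hpos⟩)
  · refine le_antisymm (σ.toStrategy.runMeasure_le_value s _) ?_
    exact (not_lt.1 hpos).trans zero_le
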